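/- Fix an o-minimal structure on $\mathbb R$ (the order is definable, and the subsets of $\mathbb R$ definable with parameters are exactly the finite unions of points and open intervals). "Definable" refers to it, and all sets and maps are definable. The empty set counts as connected. **Definitions.** A *coordinate cone* in $\mathbb R^n$ is an intersection of sets $\{x_j\,\sigma\,c\}$, $\sigma\in\{<,=,>\}$, $c\in\mathbb R$, with at most one condition for each $j$. An open bounded set $X\subset\mathbb R^n$ is *semi-monotone* if $X\cap C$ is connected for each coordinate cone $C$. A bounded upper semi-continuous function $f$ on a non-empty semi-monotone set $X$ is *submonotone* if $\{\mathbf x\in X: f(\mathbf x)<b\}$ is semi-monotone for every $b\in\mathbb R$; $f$ is *supermonotone* if $-f$ is submonotone. A function on a non-empty semi-monotone set is *monotone* if it is sub- and supermonotone and, for each $j$, it is strictly increasing in $x_j$, strictly decreasing in $x_j$, or independent of $x_j$ (with the other coordinates fixed). Let $\mathbf f=(f_1,\dots,f_k):X\to\mathbb R^k$ be a continuous bounded map on a non-empty semi-monotone set $X\subset\mathbb R^n$, with graph $\mathbf F\subset\mathbb R^{n+k}$, where $\mathbb R^{n+k}$ has coordinates $x_1,\dots,x_n,y_1,\dots,y_k$.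 A set $H=\{x_{j_1},\dots,x_{j_\alpha},y_{i_1},\dots,y_{i_\beta}\}$ of coordinates with $\alpha+\beta=n$ is a *basis set* of $\mathbf f$ if $(x_{j_1},\dots,x_{j_\alpha},f_{i_1},\dots,f_{i_\beta}):X\to\mathbb R^n$ is injective. *Monotone maps* are defined by induction on $n$. For $n=0$ every such $\mathbf f$ is monotone; for $n=1$, $\mathbf f$ is monotone if every $f_i$ is a monotone function; for $n\ge2$, $\mathbf f$ is monotone if for all $i,j$ such that $f_i$ is not independent of $x_j$: * for every $b\in\mathbb R$, the set $\mathbf F\cap\{y_i=b\}$ (considered in the space of the coordinates other than $y_i$), if non-empty, is the graph of a monotone map $\mathbf f_{i,j,b}$ from a semi-monotone subset of $\mathrm{span}\{x_1,\dots,x_{j-1},x_{j+1},\dots,x_n\}$ to $\mathrm{span}\{y_1,\dots,y_{i-1},x_j,y_{i+1},\dots,y_k\}$; * the system of basis sets of $\mathbf f_{i,j,b}$ is the same for all these $b$. **Theorem.** Let $\mathbf f:X\to\mathbb R^k$ be a monotone map on a non-empty semi-monotone set $X\subset\mathbb R^n$, with graph $\mathbf F$. 1. The system of basis sets of $\mathbf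 f$ is the system of bases of a matroid $\mathbf m$ of rank $n$ on $\{x_1,\dots,x_n,y_1,\dots,y_k\}$. 2. For each independent set $I=\{x_{j_1},\dots,x_{j_\alpha},y_{i_1},\dots,y_{i_\beta}\}$ of $\mathbf m$ (with $\alpha+\beta$ distinct elements) and all $c_1,\dots,c_\alpha,b_1,\dots,b_\beta\in\mathbb R$, the set $$\mathbf F\cap\{x_{j_1}=c_1,\dots,x_{j_\alpha}=c_\alpha,\ y_{i_1}=b_1,\dots,y_{i_\beta}=b_\beta\},$$ considered in the space of the $n+k-\alpha-\beta$ coordinates not in $I$, is, if non-empty, the graph of a monotone map from a semi-monotone subset of the span of some $n-\alpha-\beta$ of these coordinates to the span of the remaining $k$. The system of basis sets of this map is the system of bases of the contraction $\mathbf m_I$ of $\mathbf m$ by $I$, a matroid of rank $n-\alpha-\beta$ (so it does not depend on the $c$'s and $b$'s). In particular, all these non-empty sets have dimension $n-\alpha-\beta$. -/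

import Mathlib

open Set

universe u v

/-- The first-order structure `L` on `ℝ` is o-minimal: the order is definable and every subset of
`ℝ` definable with real parameters is a finite union of points and (bounded or unbounded) open
intervals. -/
structure IsOMinimal (L : FirstOrder.Language.{u, v}) [L.Structure ℝ] : Prop where
  definable_lt : (univ : Set ℝ).Definable₂ L {p : ℝ × ℝ | p.1 < p.2}
  finite_union : ∀ s : Set ℝ, (univ : Set ℝ).Definable₁ L s →
    ∃ P : Set (Set ℝ), P.Finite ∧ s = ⋃₀ P ∧
      ∀ t ∈ P, (∃ a, t = {a}) ∨ (∃ a b, t = Ioo a b) ∨ (∃ a, t = Iio a) ∨ (∃ a, t = Ioi a) ∨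
        t = univ

/-- A coordinate cone in `ℝⁿ`: each coordinate is either unrestricted, or subject to one condition
`x_j < c`, `x_j = c` or `x_j > c`. -/
def IsCoordinateCone {n : ℕ} (C : Set (Fin n → ℝ)) : Prop :=
  ∃ T : Fin n → Set ℝ,
    (∀ j, T j = univ ∨ ∃ c : ℝ, T j = Iio c ∨ T j = {c} ∨ T j = Ioi c) ∧ C = Set.pi univ T

/-- Semi-monotone sets: open, bounded, definable, with connected (possibly empty) intersections
with all coordinate cones. -/
structure IsSemiMonotone (L : FirstOrder.Language.{u, v}) [L.Structure ℝ] {n : ℕ} (X : Set (Fin n → ℝ)) :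
    Prop where
  isOpen : IsOpen X
  isBounded : Bornology.IsBounded X
  definable : (univ : Set ℝ).Definable L X
  connected : ∀ C : Set (Fin n → ℝ), IsCoordinateCone C → IsPreconnected (X ∩ C)

/-- The graph of `f : X → ℝᵏ`, `X ⊆ ℝⁿ`. The coordinates of `ℝⁿ⁺ᵏ` are labelled by
`Fin n ⊕ Fin k`: `Sum.inl j` stands for `x_j` and `Sum.inr i` for `y_i`. A map on `X` is given by a
total function of which only the values on `X` matter. -/
def mapGraph {n k : ℕ} (X : Set (Fin n → ℝ)) (f : (Fin n → ℝ) → Fin k → ℝ) :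
    Set (Fin n ⊕ Fin k → ℝ) :=
  {p | (fun j => p (Sum.inl j)) ∈ X ∧ ∀ i, p (Sum.inr i) = f (fun j => p (Sum.inl j)) i}

/-- A map `X → ℝᵏ` is definable if its graph is. -/
def IsDefinableMapOn (L : FirstOrder.Language.{u, v}) [L.Structure ℝ] {n k : ℕ} (X : Set (Fin n → ℝ))
    (f : (Fin n → ℝ) → Fin k → ℝ) : Prop :=
  (univ : Set ℝ).Definable L (mapGraph X f)

def StrictIncrInCoord {n : ℕ} (X : Set (Fin n → ℝ)) (f : (Fin n → ℝ) → ℝ) (j : Fin n) : Prop :=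
  ∀ x ∈ X, ∀ y ∈ X, (∀ l, l ≠ j → x l = y l) → x j < y j → f x < f y

def StrictDecrInCoord {n : ℕ} (X : Set (Fin n → ℝ)) (f : (Fin n → ℝ) → ℝ) (j : Fin n) : Prop :=
  ∀ x ∈ X, ∀ y ∈ X, (∀ l, l ≠ j → x l = y l) → x j < y j → f y < f x

def IndepOfCoord {n : ℕ} (X : Set (Fin n → ℝ)) (f : (Fin n → ℝ) → ℝ) (j : Fin n) : Prop :=
  ∀ x ∈ X, ∀ y ∈ X, (∀ l, l ≠ j → x l = y l) → f x = f y

/-- Submonotone functions on a non-empty semi-monotone set. -/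
structure IsSubmonotone (L : FirstOrder.Language.{u, v}) [L.Structure ℝ] {n : ℕ} (X : Set (Fin n → ℝ))
    (f : (Fin n → ℝ) → ℝ) : Prop where
  nonempty : X.Nonempty
  semiMonotone : IsSemiMonotone L X
  bounded : Bornology.IsBounded (f '' X)
  usc : UpperSemicontinuousOn f X
  sublevel : ∀ b : ℝ, IsSemiMonotone L {x | x ∈ X ∧ f x < b}

/-- Supermonotone functions: `-f` is submonotone. -/
def IsSupermonotone (L : FirstOrder.Language.{u, v}) [L.Structure ℝ] {n : ℕ} (X : Set (Fin n → ℝ))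
    (f : (Fin n → ℝ) → ℝ) : Prop :=
  IsSubmonotone L X (fun x => -f x)

/-- Monotone functions: definable, sub- and supermonotone, and strictly increasing in, strictly
decreasing in, or independent of each coordinate. -/
structure IsMonotoneFunction (L : FirstOrder.Language.{u, v}) [L.Structure ℝ] {n : ℕ} (X : Set (Fin n → ℝ))
    (f : (Fin n → ℝ) → ℝ) : Prop where
  definable : IsDefinableMapOn L X (fun x (_ : Fin 1) => f x)
  submonotone : IsSubmonotone L X f
  supermonotone : IsSupermonotone L X f
  coord : ∀ j, StrictIncrInCoord X f j ∨ StrictDecrInCoord X f j ∨ IndepOfCoord X f j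

/-- The system of basis sets of `f : X → ℝᵏ`, `X ⊆ ℝⁿ`: the sets `H` of exactly `n` of the
coordinates `x₁, …, xₙ, y₁, …, yₖ` such that the map on `X` formed by the functions corresponding
to the elements of `H` is injective. -/
def basisSystem {n k : ℕ} (X : Set (Fin n → ℝ)) (f : (Fin n → ℝ) → Fin k → ℝ) :
    Set (Set (Fin n ⊕ Fin k)) :=
  {H | H.ncard = n ∧ InjOn (fun x (h : H) => Sum.elim x (f x) (h : Fin n ⊕ Fin k)) X}

/-- The setting of the definition of monotone maps: a continuous, bounded, definable map on a
non-empty semi-monotone set. -/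
structure IsAdmissibleMap (L : FirstOrder.Language.{u, v}) [L.Structure ℝ] {n k : ℕ} (X : Set (Fin n → ℝ))
    (f : (Fin n → ℝ) → Fin k → ℝ) : Prop where
  nonempty : X.Nonempty
  semiMonotone : IsSemiMonotone L X
  definable : IsDefinableMapOn L X f
  continuous : ContinuousOn f X
  bounded : Bornology.IsBounded (f '' X)

/-- Monotone maps `f : X → ℝᵏ`, `X ⊆ ℝⁿ`, by induction on `n`.

* `n = 0` (convention, `ℝ⁰` is a point): every map is monotone.
* `n = 1`: every component is a monotone function.
* `n ≥ 2`: for all `i`, `j` such that `f_i` is not independent of `x_j`, every non-empty level set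
  `F ∩ {y_i = b}` of the graph `F` is the graph of a monotone map `g = f_{i,j,b}` in the variables
  `x_l`, `l ≠ j`, with values in `span {y_1, …, y_{i-1}, x_j, y_{i+1}, …, y_k}`, and the system of
  basis sets of `f_{i,j,b}` (here `B`) does not depend on `b`.

The point of `F ∩ {y_i = b}` whose coordinates `x_l`, `l ≠ j`, are given by `x'`, and whose
coordinates `y_1, …, y_{i-1}, x_j, y_{i+1}, …, y_k` are given by `y'`, has `x`-part
`j.insertNth (y' i) x'` and `y`-part `Function.update y' i b`. -/
def IsMonotoneMap (L : FirstOrder.Language.{u, v}) [L.Structure ℝ] {k : ℕ} :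
    (n : ℕ) → (X : Set (Fin n → ℝ)) → (f : (Fin n → ℝ) → Fin k → ℝ) → Prop
  | 0, X, f => IsAdmissibleMap L X f
  | 1, X, f => IsAdmissibleMap L X f ∧ ∀ i, IsMonotoneFunction L X (fun x => f x i)
  | n + 2, X, f => IsAdmissibleMap L X f ∧
      ∀ (i : Fin k) (j : Fin (n + 2)), ¬ IndepOfCoord X (fun x => f x i) j →
        ∃ B : Set (Set (Fin (n + 1) ⊕ Fin k)), ∀ b : ℝ, (∃ x ∈ X, f x i = b) →
          ∃ (X' : Set (Fin (n + 1) → ℝ)) (g : (Fin (n + 1) → ℝ) → Fin k → ℝ),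
            (∀ (x' : Fin (n + 1) → ℝ) (y' : Fin k → ℝ),
              Sum.elim x' y' ∈ mapGraph X' g ↔
                Sum.elim (j.insertNth (y' i) x' : Fin (n + 2) → ℝ) (Function.update y' i b) ∈
                  mapGraph X f) ∧
            IsMonotoneMap L (n + 1) X' g ∧ basisSystem X' g = B

/-- The slice `F ∩ {v = c_v for all v ∈ I}`, considered as a set in the space spanned by the
coordinates that are not in `I`. -/
def slice {V : Type*} (F : Set (V → ℝ)) (I : Set V) (c : I → ℝ) : Set ({v // v ∉ I} → ℝ) :=
  {q | ∃ p ∈ F, (∀ v : I, p v = c v) ∧ ∀ w : {v // v ∉ I}, p w = q w}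

/-- `A` has dimension `d`: this is the largest number of coordinates such that the projection of
`A` to their span has non-empty interior (for a definable set, the o-minimal dimension). -/
def HasDimension {V : Type*} (A : Set (V → ℝ)) (d : ℕ) : Prop :=
  IsGreatest {m : ℕ | ∃ s : Finset V, s.card = m ∧
    (interior ((fun (p : V → ℝ) (w : s) => p w) '' A)).Nonempty} d

/-! The theorem is about fixing coordinates one at a time. A set `H` of coordinates spans `F` if the
points of `F` are determined by their coordinates in `H`; basis sets are the spanning sets of size
`n`. Suppose that, recursively, each non-constant coordinate cuts `F` into fibers of rank one less,
all with the same spanning sets (`IsMatroidal`). Then `H ∪ {v}` spans `F` exactly when `H` spans a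
single `v`-fiber (`IsMatroidal.spans_insert_iff`). Induction on the rank shows that spanning sets
contain bases and that bases satisfy exchange (`IsMatroidal.exchange`), and fixing coordinates
becomes contraction.

It remains to see that the graph `F` of a monotone map has this property. For fibers `y_i = b` this
is essentially the definition. For `x_j = c` it must be proved that the section is a monotone map
and that a set spanning one section spans `F` once `x_j` is added (`HasMonotoneSections`). Both rest
on one observation: cuts by `x_j = c` and `y_i = b` commute, so the level sets of a section are
sections of level sets, which are graphs of monotone maps in fewer variables. Sections in one
variable are treated directly: a continuous function on an interval that is injective or constant is
a monotone function.

Matroidality in `n` variables and the statement on sections in `n + 1` variables are proved together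
by induction (`isMatroidal_mapGraph_and_hasMonotoneSections`). Fixing the elements of an independent
set in turn then gives the second claim (`IsMonotoneGraph.multiFiber`). -/

/-! ### Spanning sets and basis exchange from coordinate fibers -/

section Matroidal

variable {V W : Type*}

/-- The coordinate `v` is constant on `F`. -/
def CoordConst (F : Set (V → ℝ)) (v : V) : Prop := ∀ p ∈ F, ∀ q ∈ F, p v = q v

/-- The projection of `F` to the span of the coordinates in `H` is injective. -/
def Spans (H : Set V) (F : Set (V → ℝ)) : Prop :=
  ∀ p ∈ F, ∀ q ∈ F, (∀ v ∈ H, p v = q v) → p = q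

def coordFiber (F : Set (V → ℝ)) (v : V) (c : ℝ) : Set (V → ℝ) := {p | p ∈ F ∧ p v = c}

/-- Sets of "rank" `m`, such that every non-empty fiber of a non-constant coordinate
has rank `m - 1`, and the spanning sets of these fibers do not depend on the fiber. -/
def IsMatroidal : ℕ → Set (V → ℝ) → Prop
  | 0, F => F.Nonempty ∧ F.Subsingleton
  | m + 1, F => F.Nonempty ∧ ¬ F.Subsingleton ∧ ∀ v, ¬ CoordConst F v →
      (∀ c, (coordFiber F v c).Nonempty → IsMatroidal m (coordFiber F v c)) ∧
      ∀ c c', (coordFiber F v c).Nonempty → (coordFiber F v c').Nonempty →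
        ∀ H, Spans H (coordFiber F v c) → Spans H (coordFiber F v c')

lemma Spans.mono {H H' : Set V} {F F' : Set (V → ℝ)} (h : Spans H F) (hH : H ⊆ H')
    (hF : F' ⊆ F) : Spans H' F' :=
  fun p hp q hq hpq => h p (hF hp) q (hF hq) fun v hv => hpq v (hH hv)

lemma coordFiber_subset (F : Set (V → ℝ)) (v : V) (c : ℝ) : coordFiber F v c ⊆ F :=
  fun _ h => h.1

lemma spans_of_forall_insert {H : Set V} {F : Set (V → ℝ)} {v : V}
    (h : ∀ c, (coordFiber F v c).Nonempty → Spans H (coordFiber F v c)) :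
    Spans (insert v H) F := by
  intro p hp q hq hpq
  exact h (p v) ⟨p, hp, rfl⟩ p ⟨hp, rfl⟩ q ⟨hq, (hpq v (mem_insert _ _)).symm⟩
    fun w hw => hpq w (mem_insert_of_mem _ hw)

lemma Spans.coordFiber_of_insert {H : Set V} {F : Set (V → ℝ)} {v : V}
    (h : Spans (insert v H) F) (c : ℝ) : Spans H (coordFiber F v c) := by
  intro p hp q hq hpq
  refine h p hp.1 q hq.1 ?_
  rintro w (rfl | hw)
  · exact hp.2.trans hq.2.symm
  · exact hpq w hw

lemma Spans.diff_coordFiber {H : Set V} {F : Set (V → ℝ)} (v : V)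
    (h : Spans H F) (c : ℝ) : Spans (H \ {v}) (coordFiber F v c) := by
  refine Spans.coordFiber_of_insert (h.mono ?_ le_rfl) c
  intro w hw
  by_cases hwv : w = v
  · exact .inl hwv
  · exact .inr ⟨hw, hwv⟩

lemma IsMatroidal.nonempty {m : ℕ} {F : Set (V → ℝ)} (h : IsMatroidal m F) : F.Nonempty := by
  cases m <;> exact h.1

/-- A set containing `v` spans iff it separates points within every `v`-fiber, and the fibers share
their spanning sets, so one fiber decides. -/
lemma IsMatroidal.spans_insert_iff {m : ℕ} {F : Set (V → ℝ)} (h : IsMatroidal (m + 1) F) {v : V}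
    (hv : ¬ CoordConst F v) {c : ℝ} (hc : (coordFiber F v c).Nonempty) {H : Set V} :
    Spans (insert v H) F ↔ Spans H (coordFiber F v c) :=
  ⟨fun h => h.coordFiber_of_insert c,
    fun h' => spans_of_forall_insert fun c' hc' => (h.2.2 v hv).2 c c' hc hc' H h'⟩

lemma Spans.exists_not_coordConst {H : Set V} {F : Set (V → ℝ)} (h : Spans H F)
    (hF : ¬ F.Subsingleton) : ∃ v ∈ H, ¬ CoordConst F v := by
  by_contra! hH
  exact hF fun p hp q hq => h p hp q hq fun v hv => hH v hv p hp q hq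

lemma coordFiber_nonempty {F : Set (V → ℝ)} (hF : F.Nonempty) (v : V) :
    ∃ c, (coordFiber F v c).Nonempty :=
  ⟨hF.some v, hF.some, hF.some_mem, rfl⟩

/-- The projection of a matroidal set of rank `m` to a coordinate subspace can contain an open box
only if the dimension of the subspace is at most `m`. -/
lemma IsMatroidal.card_le_of_box {m : ℕ} {F : Set (V → ℝ)} (h : IsMatroidal m F) (s : Finset V)
    (a : V → ℝ) {ε : ℝ} (hε : 0 < ε)
    (hbox : ∀ y : V → ℝ, (∀ v ∈ s, |y v - a v| < ε) → ∃ p ∈ F, ∀ v ∈ s, p v = y v) :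
    s.card ≤ m := by
  classical
  have key : ∀ v ∈ s, ¬ CoordConst F v := by
    intro v hv hc
    obtain ⟨p, hp, hpa⟩ := hbox a (by simpa using fun _ _ => hε)
    -- The shift by `ε / 2` stays in the box and changes the value of every coordinate in `s`.
    obtain ⟨q, hq, hqa⟩ := hbox (fun w => a w + ε / 2) (by
      intro w _
      rw [add_sub_cancel_left, abs_of_pos (by positivity)]
      linarith)
    have := hc p hp q hq
    rw [hpa v hv, hqa v hv] at this
    linarith
  induction m generalizing F s with
  | zero =>
    rcases s.eq_empty_or_nonempty with rfl | ⟨v, hv⟩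
    · simp
    · exact absurd (fun p hp q hq => by rw [h.2 hp hq]) (key v hv)
  | succ m ih =>
    rcases s.eq_empty_or_nonempty with rfl | ⟨v, hv⟩
    · simp
    have hbox' : ∀ y : V → ℝ, (∀ w ∈ s.erase v, |y w - a w| < ε) →
        ∃ p ∈ coordFiber F v (a v), ∀ w ∈ s.erase v, p w = y w := by
      intro y hy
      obtain ⟨p, hp, hpy⟩ := hbox (Function.update y v (a v)) (by
        intro w hw
        by_cases hwv : w = v
        · subst hwv; simpa using hε
        · simpa [hwv] using hy w (Finset.mem_erase.2 ⟨hwv, hw⟩))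
      refine ⟨p, ⟨hp, by simpa using hpy v hv⟩, fun w hw => ?_⟩
      rw [hpy w (Finset.mem_of_mem_erase hw), Function.update_of_ne (Finset.ne_of_mem_erase hw)]
    obtain ⟨p, hp, -⟩ := hbox' a (by simpa using fun _ _ _ => hε)
    have := ih ((h.2.2 v (key v hv)).1 _ ⟨p, hp⟩) (s.erase v) hbox' (by
      intro w hw hc
      obtain ⟨p, hp, hpa⟩ := hbox' a (by simpa using fun _ _ _ => hε)
      obtain ⟨q, hq, hqa⟩ := hbox' (fun w => a w + ε / 2) (by
        intro w _
        rw [add_sub_cancel_left, abs_of_pos (by positivity)]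
        linarith)
      have := hc p hp q hq
      rw [hpa w hw, hqa w hw] at this
      linarith)
    rw [Finset.card_erase_of_mem hv] at this
    omega

variable [Finite V]

/-- Greedy choice: a spanning set of a set with more than one point contains a non-constant
coordinate `v`; the rest of `H` spans a `v`-fiber, whose rank is smaller. -/
lemma IsMatroidal.exists_basis {m : ℕ} {F : Set (V → ℝ)} (h : IsMatroidal m F) {H : Set V}
    (hH : Spans H F) : ∃ B ⊆ H, B.ncard = m ∧ Spans B F := by
  induction m generalizing F H with
  | zero => exact ⟨∅, empty_subset _, ncard_empty _, fun p hp q hq _ => h.2 hp hq⟩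
  | succ m ih =>
    obtain ⟨v, hv, hvF⟩ := hH.exists_not_coordConst h.2.1
    obtain ⟨c, hc⟩ := coordFiber_nonempty h.nonempty v
    obtain ⟨B, hBH, hB, hBs⟩ := ih ((h.2.2 v hvF).1 c hc) (hH.diff_coordFiber v c)
    have hvB : v ∉ B := fun hvB => (hBH hvB).2 rfl
    exact ⟨insert v B, insert_subset hv (hBH.trans sdiff_subset),
      by rw [ncard_insert_of_notMem hvB, hB], (h.spans_insert_iff hvF hc).2 hBs⟩

lemma IsMatroidal.le_ncard {m : ℕ} {F : Set (V → ℝ)} (h : IsMatroidal m F) {H : Set V}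
    (hH : Spans H F) : m ≤ H.ncard := by
  obtain ⟨B, hBH, rfl, -⟩ := h.exists_basis hH
  exact ncard_le_ncard hBH

/-- A constant coordinate could be dropped from `H`, leaving a spanning set with fewer than `m`
elements. -/
lemma IsMatroidal.not_coordConst {m : ℕ} {F : Set (V → ℝ)} (h : IsMatroidal m F) {H : Set V}
    (hm : H.ncard = m) (hH : Spans H F) {v : V} (hv : v ∈ H) : ¬ CoordConst F v := by
  intro hc
  have := h.le_ncard (H := H \ {v}) fun p hp q hq hpq => hH p hp q hq fun w hw => by
    by_cases hwv : w = v
    · exact hwv ▸ hc p hp q hq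
    · exact hpq w ⟨hw, hwv⟩
  have := ncard_sdiff_singleton_lt_of_mem hv
  omega

/-- An element `w ≠ a` of `A` is kept by the exchange, so it may be fixed and the exchange carried
out in a `w`-fiber. Only a one-element `A` leaves no such `w`. -/
lemma IsMatroidal.exchange {m : ℕ} {F : Set (V → ℝ)} (h : IsMatroidal m F) :
    Matroid.ExchangeProperty fun H : Set V => H.ncard = m ∧ Spans H F := by
  induction m generalizing F with
  | zero =>
    rintro A B ⟨hA, -⟩ - a ⟨ha, -⟩
    simp [(ncard_eq_zero).1 hA] at ha
  | succ m ih =>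
    rintro A B ⟨hA, hAs⟩ ⟨hB, hBs⟩ a ⟨haA, haB⟩
    have hcard : (A \ {a}).ncard = m := by rw [ncard_sdiff_singleton_of_mem haA, hA]; rfl
    by_cases hw : ∃ w ∈ A, w ≠ a
    · obtain ⟨w, hwA, hwa⟩ := hw
      have hwF := h.not_coordConst hA hAs hwA
      obtain ⟨c, hc⟩ := coordFiber_nonempty h.nonempty w
      have hfib := (h.2.2 w hwF).1 c hc
      -- If `w ∉ B`, then `B \ {w}` still has `m + 1` elements, one too many for a basis of the
      -- fiber.
      obtain ⟨B', hB'B, hB', hB's⟩ := hfib.exists_basis (hBs.diff_coordFiber w c)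
      obtain ⟨b, ⟨hbB, hbA⟩, hb, hbs⟩ := ih hfib (A \ {w}) B'
        ⟨by rw [ncard_sdiff_singleton_of_mem hwA, hA]; rfl, hAs.diff_coordFiber w c⟩ ⟨hB', hB's⟩ a
        ⟨⟨haA, hwa.symm⟩, fun h' => haB (hB'B h').1⟩
      have hbw : b ≠ w := fun h' => (hB'B hbB).2 h'
      have hbA' : b ∉ A := fun h' => hbA ⟨h', hbw⟩
      refine ⟨b, ⟨(hB'B hbB).1, hbA'⟩, ?_, ?_⟩
      · rw [ncard_insert_of_notMem (fun h' => hbA' h'.1), hcard]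
      · refine ((h.spans_insert_iff hwF hc).2 hbs).mono ?_ le_rfl
        intro x
        simp only [mem_insert_iff, mem_sdiff, mem_singleton_iff]
        rintro (rfl | rfl | ⟨⟨h1, -⟩, h2⟩)
        · exact .inr ⟨hwA, hwa⟩
        · exact .inl rfl
        · exact .inr ⟨h1, h2⟩
    · push Not at hw
      have hAa : A = {a} := by
        ext x; exact ⟨fun hx => hw x hx, fun hx => by rw [mem_singleton_iff.1 hx]; exact haA⟩
      subst hAa
      rw [ncard_singleton] at hA
      rw [← hA, ncard_eq_one] at hB
      obtain ⟨b, rfl⟩ := hB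
      refine ⟨b, ⟨rfl, fun h' => haB (by rw [mem_singleton_iff.1 h']; rfl)⟩, ?_⟩
      simpa using ⟨by omega, hBs⟩

/-- The definition of monotone maps compares only basis systems of level sets; this upgrades the
comparison to all spanning sets. -/
lemma IsMatroidal.spans_iff_of_bases {m : ℕ} {F F' : Set (V → ℝ)} (h : IsMatroidal m F)
    (hF : ∀ H : Set V, H.ncard = m → Spans H F → Spans H F') {H : Set V} (hH : Spans H F) :
    Spans H F' := by
  obtain ⟨B, hBH, hB, hBs⟩ := h.exists_basis hH
  exact (hF B hB hBs).mono hBH le_rfl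

/-- The matroid of a matroidal set. -/
def IsMatroidal.matroid {m : ℕ} {F : Set (V → ℝ)} (h : IsMatroidal m F) : Matroid V :=
  Matroid.ofIsBaseOfFinite (E := univ) finite_univ (fun H : Set V => H.ncard = m ∧ Spans H F)
    (by
      obtain ⟨B, -, hB⟩ := h.exists_basis (H := univ) fun p _ q _ hpq => funext fun v => hpq v trivial
      exact ⟨B, hB⟩)
    h.exchange (fun _ _ => subset_univ _)

lemma IsMatroidal.matroid_isBase {m : ℕ} {F : Set (V → ℝ)} (h : IsMatroidal m F) {H : Set V} :
    h.matroid.IsBase H ↔ H.ncard = m ∧ Spans H F := by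
  simp [IsMatroidal.matroid]

lemma IsMatroidal.matroid_E {m : ℕ} {F : Set (V → ℝ)} (h : IsMatroidal m F) :
    h.matroid.E = univ := rfl

end Matroidal

/-! ### Placing sets of lower-dimensional spaces in the ambient coordinates -/

section Extension

variable {V W : Type*}

/-- The set of points of `ℝ^V` whose coordinates in the range of `e` form a point of `G`, while the
other coordinates are fixed. -/
def extendCoords (e : W → V) (c : V → ℝ) (G : Set (W → ℝ)) : Set (V → ℝ) :=
  {q | (∀ v ∉ range e, q v = c v) ∧ q ∘ e ∈ G}

lemma exists_mem_extendCoords {e : W → V} (he : e.Injective) (c : V → ℝ) {G : Set (W → ℝ)}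
    {p : W → ℝ} (hp : p ∈ G) : ∃ q ∈ extendCoords e c G, q ∘ e = p := by
  refine ⟨Function.extend e p c, ⟨fun v hv => ?_, ?_⟩, funext fun w => he.extend_apply _ _ w⟩
  · exact Function.extend_apply' _ _ _ fun ⟨w, hw⟩ => hv ⟨w, hw⟩
  · rwa [show Function.extend e p c ∘ e = p from funext fun w => he.extend_apply _ _ w]

lemma extendCoords_ext {e : W → V} {c : V → ℝ} {G : Set (W → ℝ)} {p q : V → ℝ}
    (hp : p ∈ extendCoords e c G) (hq : q ∈ extendCoords e c G) (h : p ∘ e = q ∘ e) : p = q := by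
  funext v
  by_cases hv : v ∈ range e
  · obtain ⟨w, rfl⟩ := hv
    exact congrFun h w
  · rw [hp.1 v hv, hq.1 v hv]

lemma spans_extendCoords_iff {e : W → V} (he : e.Injective) (c : V → ℝ) {G : Set (W → ℝ)}
    {H : Set V} : Spans H (extendCoords e c G) ↔ Spans (e ⁻¹' H) G := by
  constructor
  · intro h p hp q hq hpq
    obtain ⟨p', hp', rfl⟩ := exists_mem_extendCoords he c hp
    obtain ⟨q', hq', rfl⟩ := exists_mem_extendCoords he c hq
    rw [h p' hp' q' hq']
    intro v hv
    by_cases hve : v ∈ range e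
    · obtain ⟨w, rfl⟩ := hve
      exact hpq w hv
    · rw [hp'.1 v hve, hq'.1 v hve]
  · intro h p hp q hq hpq
    exact extendCoords_ext hp hq (h _ hp.2 _ hq.2 fun w hw => hpq (e w) hw)

lemma coordConst_extendCoords_iff {e : W → V} (he : e.Injective) (c : V → ℝ) {G : Set (W → ℝ)}
    {w : W} : CoordConst (extendCoords e c G) (e w) ↔ CoordConst G w := by
  constructor
  · intro h p hp q hq
    obtain ⟨p', hp', rfl⟩ := exists_mem_extendCoords he c hp
    obtain ⟨q', hq', rfl⟩ := exists_mem_extendCoords he c hq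
    exact h p' hp' q' hq'
  · intro h p hp q hq
    exact h _ hp.2 _ hq.2

lemma extendCoords_nonempty_iff {e : W → V} (he : e.Injective) (c : V → ℝ) {G : Set (W → ℝ)} :
    (extendCoords e c G).Nonempty ↔ G.Nonempty :=
  ⟨fun ⟨_, hp⟩ => ⟨_, hp.2⟩, fun ⟨_, hp⟩ =>
    let ⟨q, hq, _⟩ := exists_mem_extendCoords he c hp; ⟨q, hq⟩⟩

lemma coordFiber_extendCoords (e : W → V) (c : V → ℝ) (G : Set (W → ℝ)) (w : W) (b : ℝ) :
    coordFiber (extendCoords e c G) (e w) b = extendCoords e c (coordFiber G w b) := by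
  ext p
  simp only [coordFiber, extendCoords, mem_ofPred_eq, Function.comp_apply, and_assoc]

lemma mem_range_of_not_coordConst_extendCoords {e : W → V} {c : V → ℝ} {G : Set (W → ℝ)} {v : V}
    (h : ¬ CoordConst (extendCoords e c G) v) : v ∈ range e := by
  by_contra hv
  exact h fun p hp q hq => by rw [hp.1 v hv, hq.1 v hv]

lemma IsMatroidal.extendCoords {m : ℕ} {e : W → V} (he : e.Injective) (c : V → ℝ)
    {G : Set (W → ℝ)} (h : IsMatroidal m G) : IsMatroidal m (extendCoords e c G) := by
  induction m generalizing G with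
  | zero =>
    exact ⟨(extendCoords_nonempty_iff he c).2 h.1,
      fun p hp q hq => extendCoords_ext hp hq (h.2 hp.2 hq.2)⟩
  | succ m ih =>
    refine ⟨(extendCoords_nonempty_iff he c).2 h.1, fun hs => h.2.1 fun p hp q hq => ?_,
      fun v hv => ?_⟩
    · obtain ⟨p', hp', rfl⟩ := exists_mem_extendCoords he c hp
      obtain ⟨q', hq', rfl⟩ := exists_mem_extendCoords he c hq
      rw [hs hp' hq']
    · obtain ⟨w, rfl⟩ := mem_range_of_not_coordConst_extendCoords hv
      rw [coordConst_extendCoords_iff he] at hv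
      obtain ⟨h1, h2⟩ := h.2.2 w hv
      simp only [coordFiber_extendCoords, extendCoords_nonempty_iff he, spans_extendCoords_iff he]
      exact ⟨fun b hb => ih (h1 b hb), fun b b' hb hb' H => h2 b b' hb hb' _⟩

end Extension

/-! ### Definability of fibers and half-spaces -/

section Definability

variable {L : FirstOrder.Language.{u, v}} [L.Structure ℝ] {V W : Type*}

lemma Set.Definable.coordFiber {F : Set (V → ℝ)} (hF : (univ : Set ℝ).Definable L F)
    (v : V) (c : ℝ) : (univ : Set ℝ).Definable L (coordFiber F v c) := by
  have h : (univ : Set ℝ).Definable₁ L {c} := Set.Definable.singleton_of_mem L (mem_univ c)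
  exact hF.inter (h.preimage_comp (fun _ : Fin 1 => v))

lemma Set.Definable.of_extendCoords [Finite V] [Finite W] {e : W → V} (he : e.Injective)
    {c : V → ℝ} {G : Set (W → ℝ)} (h : (univ : Set ℝ).Definable L (extendCoords e c G)) :
    (univ : Set ℝ).Definable L G := by
  convert h.image_comp e using 1
  ext p
  constructor
  · intro hp
    exact exists_mem_extendCoords he c hp
  · rintro ⟨q, hq, rfl⟩
    exact hq.2

/-- The half-line `t < c` is the projection of the fiber of the order relation over second
coordinate `c`. -/
lemma IsOMinimal.definable_coord_lt (hL : IsOMinimal L) (v : V) (c : ℝ) :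
    (univ : Set ℝ).Definable L {p : V → ℝ | p v < c} := by
  have h := ((hL.definable_lt.coordFiber 1 c).image_comp (fun _ : Fin 1 => (0 : Fin 2))).preimage_comp
    (fun _ : Fin 1 => v)
  convert h using 1
  ext p
  constructor
  · intro hp
    exact ⟨![p v, c], ⟨hp, rfl⟩, funext fun _ => rfl⟩
  · rintro ⟨q, ⟨hq, hqc⟩, hqp⟩
    have h0 : q 0 = p v := congrFun hqp 0
    change q 0 < q 1 at hq
    rw [h0, hqc] at hq
    exact hq

lemma IsOMinimal.definable_lt_coord (hL : IsOMinimal L) (v : V) (c : ℝ) :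
    (univ : Set ℝ).Definable L {p : V → ℝ | c < p v} := by
  have h : (univ : Set ℝ).Definable L {p : V → ℝ | p v = c} :=
    (Set.Definable.singleton_of_mem L (mem_univ c) : (univ : Set ℝ).Definable₁ L {c}).preimage_comp
      (fun _ : Fin 1 => v)
  convert ((hL.definable_coord_lt v c).union h).compl using 1
  ext p
  change c < p v ↔ ¬ (p v < c ∨ p v = c)
  rw [← le_iff_lt_or_eq, not_le]

end Definability

/-! ### Sections of graphs by hyperplanes `x_j = c` -/

section Restriction

variable {L : FirstOrder.Language.{u, v}} [L.Structure ℝ] {n k : ℕ}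

/-- The restriction of `X` to the hyperplane `x_j = c`. -/
def sectionSet (j : Fin (n + 1)) (c : ℝ) (X : Set (Fin (n + 1) → ℝ)) : Set (Fin n → ℝ) :=
  {x | (j.insertNth c x : Fin (n + 1) → ℝ) ∈ X}

def sectionMap (j : Fin (n + 1)) (c : ℝ) (f : (Fin (n + 1) → ℝ) → Fin k → ℝ) :
    (Fin n → ℝ) → Fin k → ℝ :=
  fun x => f (j.insertNth c x)

def sectionEmb (k : ℕ) (j : Fin (n + 1)) : Fin n ⊕ Fin k → Fin (n + 1) ⊕ Fin k :=
  Sum.map j.succAbove id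

lemma sectionEmb_injective (j : Fin (n + 1)) : (sectionEmb k j).Injective :=
  Fin.succAbove_right_injective.sumMap Function.injective_id

lemma range_sectionEmb (j : Fin (n + 1)) : range (sectionEmb k j) = {Sum.inl j}ᶜ := by
  ext (l | i)
  · simp only [sectionEmb, mem_range, Sum.exists, Sum.map_inl, Sum.inl.injEq, Sum.map_inr,
      reduceCtorEq, exists_false, or_false, mem_compl_iff, mem_singleton_iff]
    exact Fin.exists_succAbove_eq_iff
  · simp [sectionEmb]

lemma insertNth_removeNth_of_eq {j : Fin (n + 1)} {c : ℝ} {x : Fin (n + 1) → ℝ} (h : x j = c) :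
    (j.insertNth c (fun l => x (j.succAbove l)) : Fin (n + 1) → ℝ) = x := by
  rw [← h]
  exact Fin.insertNth_self_removeNth j x

/-- Once the coordinate `j.succAbove l` is removed, the old coordinate `j` has index `l.predAbove
j`. This is the bookkeeping for cutting by `x_j = c` and a level set in either order. -/
lemma insertNth_insertNth_swap (j : Fin (n + 2)) (l : Fin (n + 1)) (a c : ℝ) (x : Fin n → ℝ) :
    (j.insertNth c (l.insertNth a x : Fin (n + 1) → ℝ) : Fin (n + 2) → ℝ) =
      (j.succAbove l).insertNth a ((l.predAbove j).insertNth c x : Fin (n + 1) → ℝ) := by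
  have hj : (j.succAbove l).succAbove (l.predAbove j) = j :=
    Fin.succAbove_succAbove_predAbove j l
  symm
  rw [Fin.insertNth_eq_iff]
  refine ⟨by simp, ?_⟩
  rw [Fin.insertNth_eq_iff]
  refine ⟨?_, ?_⟩
  · simp only [Fin.removeNth]
    rw [hj]; simp
  · rw [← Fin.removeNth_removeNth_eq_swap]
    simp

lemma coordFiber_eq_extendCoords (j : Fin (n + 1)) (c : ℝ) (X : Set (Fin (n + 1) → ℝ)) :
    coordFiber X j c = extendCoords j.succAbove (fun _ => c) (sectionSet j c X) := by
  ext x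
  have h : (∀ v ∉ range j.succAbove, x v = c) ↔ x j = c := by simp [Fin.range_succAbove]
  rw [extendCoords, mem_ofPred_eq, h, coordFiber, mem_ofPred_eq, and_comm]
  refine and_congr_right fun hx => ?_
  simp only [sectionSet, mem_ofPred_eq]
  rw [show x ∘ j.succAbove = fun l => x (j.succAbove l) from rfl, insertNth_removeNth_of_eq hx]

lemma coordFiber_mapGraph_inl (j : Fin (n + 1)) (c : ℝ) (X : Set (Fin (n + 1) → ℝ))
    (f : (Fin (n + 1) → ℝ) → Fin k → ℝ) :
    coordFiber (mapGraph X f) (Sum.inl j) c =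
      extendCoords (sectionEmb k j) (fun _ => c) (mapGraph (sectionSet j c X) (sectionMap j c f)) := by
  ext p
  have h : (∀ v ∉ range (sectionEmb k j), p v = c) ↔ p (Sum.inl j) = c := by
    simp [range_sectionEmb]
  rw [extendCoords, mem_ofPred_eq, h, coordFiber, mem_ofPred_eq, and_comm]
  refine and_congr_right fun hx => ?_
  have := insertNth_removeNth_of_eq (x := fun l => p (Sum.inl l)) hx
  simp only [mapGraph, sectionSet, sectionMap, sectionEmb, mem_ofPred_eq, Function.comp_apply,
    Sum.map_inl, Sum.map_inr, id, this]

lemma IsSemiMonotone.section {X : Set (Fin (n + 1) → ℝ)} (h : IsSemiMonotone L X)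
    (j : Fin (n + 1)) (c : ℝ) : IsSemiMonotone L (sectionSet j c X) where
  isOpen := h.isOpen.preimage (by fun_prop : Continuous fun x : Fin n → ℝ =>
    (j.insertNth c x : Fin (n + 1) → ℝ))
  isBounded := by
    obtain ⟨R, hR⟩ := h.isBounded.subset_closedBall 0
    refine (Metric.isBounded_closedBall (x := (0 : Fin n → ℝ)) (r := R)).subset fun x hx => ?_
    have := hR hx
    rw [mem_closedBall_zero_iff] at this ⊢
    have hR0 := (norm_nonneg _).trans this
    rw [pi_norm_le_iff_of_nonneg hR0] at this ⊢
    intro l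
    simpa using this (j.succAbove l)
  definable := by
    have := h.definable.coordFiber j c
    rw [coordFiber_eq_extendCoords] at this
    exact this.of_extendCoords Fin.succAbove_right_injective
  connected := by
    rintro C ⟨T, hT, rfl⟩
    have hC : IsCoordinateCone (Set.pi univ (j.insertNth {c} T : Fin (n + 1) → Set ℝ)) := by
      refine ⟨_, fun l => ?_, rfl⟩
      rcases Fin.eq_self_or_eq_succAbove j l with rfl | ⟨l, rfl⟩
      · exact .inr ⟨c, by simp⟩
      · simpa using hT l
    have himg := (h.connected _ hC).image (fun x l => x (j.succAbove l)) (by fun_prop)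
    convert himg using 1
    ext x
    constructor
    · rintro ⟨hx, hxT⟩
      refine ⟨j.insertNth c x, ⟨hx, fun l _ => ?_⟩, by ext; simp⟩
      rcases Fin.eq_self_or_eq_succAbove j l with rfl | ⟨l, rfl⟩
      · simp
      · simpa using hxT l trivial
    · rintro ⟨y, ⟨hy, hyT⟩, rfl⟩
      have hyj : y j = c := by simpa using hyT j trivial
      refine ⟨?_, fun l _ => by simpa using hyT (j.succAbove l) trivial⟩
      simpa only [sectionSet, mem_ofPred_eq, insertNth_removeNth_of_eq hyj] using hy

lemma IsAdmissibleMap.section {X : Set (Fin (n + 1) → ℝ)} {f : (Fin (n + 1) → ℝ) → Fin k → ℝ}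
    (h : IsAdmissibleMap L X f) {j : Fin (n + 1)} {c : ℝ} (hne : (sectionSet j c X).Nonempty) :
    IsAdmissibleMap L (sectionSet j c X) (sectionMap j c f) where
  nonempty := hne
  semiMonotone := h.semiMonotone.section j c
  definable := by
    have := Set.Definable.coordFiber h.definable (Sum.inl j) c
    rw [coordFiber_mapGraph_inl] at this
    exact this.of_extendCoords (sectionEmb_injective j)
  continuous := h.continuous.comp (f := fun x : Fin n → ℝ => (j.insertNth c x : Fin (n + 1) → ℝ))
    (by fun_prop) (fun _ hx => hx)
  bounded := h.bounded.subset (by rintro _ ⟨x, hx, rfl⟩; exact ⟨_, hx, rfl⟩)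

lemma sumElim_mem_mapGraph {X : Set (Fin n → ℝ)} {f : (Fin n → ℝ) → Fin k → ℝ} {x : Fin n → ℝ}
    {y : Fin k → ℝ} : Sum.elim x y ∈ mapGraph X f ↔ x ∈ X ∧ y = f x := by
  simp [mapGraph, funext_iff]

lemma mem_mapGraph_iff {X : Set (Fin n → ℝ)} {f : (Fin n → ℝ) → Fin k → ℝ}
    {p : Fin n ⊕ Fin k → ℝ} : p ∈ mapGraph X f ↔ ∃ x ∈ X, p = Sum.elim x (f x) := by
  constructor
  · rintro ⟨h1, h2⟩
    refine ⟨_, h1, ?_⟩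
    ext (l | i)
    · rfl
    · exact h2 i
  · rintro ⟨x, hx, rfl⟩
    exact sumElim_mem_mapGraph.2 ⟨hx, rfl⟩

lemma mem_basisSystem_iff {X : Set (Fin n → ℝ)} {f : (Fin n → ℝ) → Fin k → ℝ}
    {H : Set (Fin n ⊕ Fin k)} : H ∈ basisSystem X f ↔ H.ncard = n ∧ Spans H (mapGraph X f) := by
  refine and_congr_right fun _ => ⟨fun h p hp q hq hpq => ?_, fun h x hx y hy hxy => ?_⟩
  · obtain ⟨x, hx, rfl⟩ := mem_mapGraph_iff.1 hp
    obtain ⟨y, hy, rfl⟩ := mem_mapGraph_iff.1 hq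
    rw [h hx hy (funext fun w => hpq w w.2)]
  · have := h _ (mem_mapGraph_iff.2 ⟨x, hx, rfl⟩) _ (mem_mapGraph_iff.2 ⟨y, hy, rfl⟩)
      fun v hv => congrFun hxy ⟨v, hv⟩
    exact funext fun l => congrFun this (Sum.inl l)

lemma exists_update_mem {ι : Type*} [DecidableEq ι] {X : Set (ι → ℝ)}
    (hX : IsOpen X) {x : ι → ℝ} (hx : x ∈ X) (j : ι) : ∃ t ≠ x j, Function.update x j t ∈ X := by
  have h : ∀ᶠ t in nhds (x j), Function.update x j t ∈ X := by
    have hc : Continuous fun t : ℝ => Function.update x j t := by fun_prop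
    refine hc.continuousAt.eventually_mem (hX.mem_nhds ?_)
    simpa using hx
  obtain ⟨t, ht, hne⟩ := ((h.filter_mono nhdsWithin_le_nhds).and
    (self_mem_nhdsWithin : {x j}ᶜ ∈ nhdsWithin (x j) {x j}ᶜ)).exists
  exact ⟨t, hne, ht⟩

/-- Within a ball of the sup metric, one point can be turned into another by changing one coordinate
at a time, so `f` is locally constant on a connected set. -/
lemma eq_of_forall_indepOfCoord {X : Set (Fin n → ℝ)} (hX : IsOpen X) (hc : IsPreconnected X)
    {f : (Fin n → ℝ) → ℝ} (hf : ∀ j, IndepOfCoord X f j) {x y : Fin n → ℝ} (hx : x ∈ X)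
    (hy : y ∈ X) : f x = f y := by
  refine hc.induction₂ (fun x y => f x = f y) (fun x hx => ?_) (fun _ _ _ _ _ _ => Eq.trans)
    (fun _ _ _ _ => Eq.symm) hx hy
  obtain ⟨ε, hε, hball⟩ := Metric.isOpen_iff.1 hX x hx
  filter_upwards [mem_nhdsWithin_of_mem_nhds (Metric.ball_mem_nhds x hε)] with y hy
  have hmem : ∀ s : Finset (Fin n), s.piecewise y x ∈ X := by
    intro s
    apply hball
    rw [Metric.mem_ball, dist_pi_lt_iff hε] at hy ⊢
    intro l
    by_cases hl : l ∈ s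
    · simpa [hl] using hy l
    · simpa [hl] using hε
  have key : ∀ s : Finset (Fin n), f x = f (s.piecewise y x) := by
    intro s
    induction s using Finset.induction_on with
    | empty => simp
    | insert a s ha ih =>
      rw [ih]
      refine hf a _ (hmem _) _ (hmem _) fun l hl => ?_
      simp [Finset.piecewise, Finset.mem_insert, hl]
  simpa using key Finset.univ

lemma IsSemiMonotone.isPreconnected {X : Set (Fin n → ℝ)} (h : IsSemiMonotone L X) :
    IsPreconnected X := by
  have := h.connected univ ⟨fun _ => univ, fun _ => .inl rfl, by simp⟩
  rwa [inter_univ] at this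

lemma IsAdmissibleMap.exists_not_indepOfCoord {X : Set (Fin n → ℝ)}
    {f : (Fin n → ℝ) → Fin k → ℝ} (h : IsAdmissibleMap L X f) {i : Fin k}
    (hi : ¬ CoordConst (mapGraph X f) (Sum.inr i)) :
    ∃ j, ¬ IndepOfCoord X (fun x => f x i) j := by
  by_contra! hj
  refine hi fun p hp q hq => ?_
  obtain ⟨x, hx, rfl⟩ := mem_mapGraph_iff.1 hp
  obtain ⟨y, hy, rfl⟩ := mem_mapGraph_iff.1 hq
  exact eq_of_forall_indepOfCoord h.semiMonotone.isOpen h.semiMonotone.isPreconnected hj hx hy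

end Restriction

/-! ### Monotone functions of one variable -/

section OneVariable

variable {L : FirstOrder.Language.{u, v}} [L.Structure ℝ]

lemma isPreconnected_of_ordConnected {A : Set (Fin 1 → ℝ)}
    (h : {t : ℝ | (fun _ => t) ∈ A}.OrdConnected) : IsPreconnected A := by
  have := h.isPreconnected.image (fun t (_ : Fin 1) => t) (by fun_prop)
  convert this using 1
  ext x
  have hx : (fun _ => x 0) = x := by ext l; rw [Fin.eq_zero l]
  constructor
  · intro h
    exact ⟨x 0, by rwa [mem_ofPred_eq, hx], hx⟩
  · rintro ⟨t, ht, rfl⟩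
    exact ht

lemma IsPreconnected.ordConnected_fin_one {A : Set (Fin 1 → ℝ)} (h : IsPreconnected A) :
    {t : ℝ | (fun _ => t) ∈ A}.OrdConnected := by
  have := (h.image (fun x => x 0) (by fun_prop)).ordConnected
  suffices hA : {t : ℝ | (fun _ => t) ∈ A} = (fun x => x 0) '' A by rwa [hA]
  ext t
  constructor
  · intro ht
    exact ⟨_, ht, rfl⟩
  · rintro ⟨x, hx, rfl⟩
    have : (fun _ => x 0) = x := by ext l; rw [Fin.eq_zero l]
    rwa [mem_ofPred_eq, this]

lemma ContinuousOn.strictMonoOn_of_injOn_ordConnected {S : Set ℝ} (hS : S.OrdConnected)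
    (hne : S.Nonempty) {g : ℝ → ℝ} (hg : ContinuousOn g S) (hi : InjOn g S) :
    StrictMonoOn g S ∨ StrictAntiOn g S := by
  have : Inhabited S := Classical.inhabited_of_nonempty hne.to_subtype
  have : StrictMono (S.domRestrict g) ∨ StrictAnti (S.domRestrict g) :=
    Continuous.strictMono_of_inj hg.domRestrict hi.injective
  exact this.imp strictMono_domRestrict.mp strictAntiOn_iff_strictAnti.mpr

lemma IsSemiMonotone.isSubmonotone_fin_one {X : Set (Fin 1 → ℝ)} (hX : IsSemiMonotone L X)
    (hne : X.Nonempty) {f : (Fin 1 → ℝ) → ℝ} (hb : Bornology.IsBounded (f '' X))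
    (hc : ContinuousOn f X)
    (hd : ∀ b : ℝ, (univ : Set ℝ).Definable L {x | x ∈ X ∧ f x < b})
    (hf : MonotoneOn (fun t : ℝ => f fun _ => t) {t | (fun _ => t) ∈ X} ∨
      AntitoneOn (fun t : ℝ => f fun _ => t) {t | (fun _ => t) ∈ X}) : IsSubmonotone L X f where
  nonempty := hne
  semiMonotone := hX
  bounded := hb
  usc := hc.upperSemicontinuousOn
  sublevel b :=
    { isOpen := hc.isOpen_inter_preimage hX.isOpen isOpen_Iio
      isBounded := hX.isBounded.subset fun _ h => h.1
      definable := hd b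
      connected := by
        intro C hC
        have hXC := (hX.connected C hC).ordConnected_fin_one
        refine isPreconnected_of_ordConnected ⟨?_⟩
        rintro r ⟨⟨hrX, hr⟩, hrC⟩ t ⟨⟨htX, ht⟩, htC⟩ s ⟨hrs, hst⟩
        -- Between two points of the sublevel set, `f` is bounded by its value at one of the
        -- endpoints.
        obtain ⟨hsX, hsC⟩ := hXC.out ⟨hrX, hrC⟩ ⟨htX, htC⟩ ⟨hrs, hst⟩
        refine ⟨⟨hsX, ?_⟩, hsC⟩
        rcases hf with hf | hf
        · exact (hf hsX htX hst).trans_lt ht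
        · exact (hf hrX hsX hrs).trans_lt hr }

/-- A continuous injective function on an interval is strictly monotone, and sublevel sets of a
monotone or antitone function on an interval are order-connected. Definability of the order makes
these sets definable. -/
lemma IsAdmissibleMap.isMonotoneFunction_fin_one (hL : IsOMinimal L) {k : ℕ}
    {X : Set (Fin 1 → ℝ)} {f : (Fin 1 → ℝ) → Fin k → ℝ} (h : IsAdmissibleMap L X f) (i : Fin k)
    (hf : (∀ x ∈ X, ∀ y ∈ X, f x i = f y i → x = y) ∨ IndepOfCoord X (fun x => f x i) 0) :
    IsMonotoneFunction L X (fun x => f x i) := by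
  have hgraph : IsDefinableMapOn L X (fun x (_ : Fin 1) => f x i) := by
    rw [IsDefinableMapOn]
    convert Set.Definable.image_comp h.definable (Sum.map id fun _ => i : Fin 1 ⊕ Fin 1 → _) using 1
    ext p
    rw [mem_mapGraph_iff]
    constructor
    · rintro ⟨x, hx, rfl⟩
      refine ⟨_, mem_mapGraph_iff.2 ⟨x, hx, rfl⟩, ?_⟩
      ext (l | l) <;> rfl
    · rintro ⟨q, hq, rfl⟩
      obtain ⟨x, hx, rfl⟩ := mem_mapGraph_iff.1 hq
      refine ⟨x, hx, ?_⟩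
      ext (l | l) <;> rfl
  -- Such a set is the projection to `x` of the part of the graph lying in `T`.
  have hproj : ∀ {T : Set (Fin 1 ⊕ Fin 1 → ℝ)}, (univ : Set ℝ).Definable L T →
      (univ : Set ℝ).Definable L {x | x ∈ X ∧ Sum.elim x (fun _ => f x i) ∈ T} := by
    intro T hT
    convert (Set.Definable.inter hgraph hT).image_comp (Sum.inl : Fin 1 → _) using 1
    ext x
    constructor
    · rintro ⟨hx, hxT⟩
      exact ⟨_, ⟨mem_mapGraph_iff.2 ⟨x, hx, rfl⟩, hxT⟩, rfl⟩
    · rintro ⟨q, ⟨hq, hqT⟩, rfl⟩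
      obtain ⟨x, hx, rfl⟩ := mem_mapGraph_iff.1 hq
      exact ⟨hx, hqT⟩
  have hci : ContinuousOn (fun x => f x i) X := (continuousOn_pi.1 h.continuous) i
  have hbi : Bornology.IsBounded ((fun x => f x i) '' X) := by
    have := (LipschitzWith.eval (α := fun _ : Fin k => ℝ) i).isBounded_image h.bounded
    rwa [image_image] at this
  have hX := h.semiMonotone
  have hS := hX.isPreconnected.ordConnected_fin_one
  have hconst : ∀ x : Fin 1 → ℝ, (fun _ => x 0) = x := fun x => by ext l; rw [Fin.eq_zero l]
  have key : StrictMonoOn (fun t : ℝ => f (fun _ => t) i) {t | (fun _ => t) ∈ X} ∨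
      StrictAntiOn (fun t : ℝ => f (fun _ => t) i) {t | (fun _ => t) ∈ X} ∨
      IndepOfCoord X (fun x => f x i) 0 := by
    rcases hf with hf | hf
    · rw [← or_assoc]
      left
      refine ContinuousOn.strictMonoOn_of_injOn_ordConnected hS ?_ ?_ ?_
      · obtain ⟨x, hx⟩ := h.nonempty
        exact ⟨x 0, by rwa [mem_ofPred_eq, hconst]⟩
      · exact hci.comp (f := fun (t : ℝ) (_ : Fin 1) => t) (by fun_prop) fun _ ht => ht
      · exact fun s hs t ht hst => congrFun (hf _ hs _ ht hst) 0
    · exact .inr (.inr hf)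
  have hmono : MonotoneOn (fun t : ℝ => f (fun _ => t) i) {t | (fun _ => t) ∈ X} ∨
      AntitoneOn (fun t : ℝ => f (fun _ => t) i) {t | (fun _ => t) ∈ X} := by
    rcases key with h | h | h
    · exact .inl h.monotoneOn
    · exact .inr h.antitoneOn
    · exact .inl fun s hs t ht _ => (h _ hs _ ht fun l hl => absurd (Fin.eq_zero l) hl).le
  refine ⟨hgraph, hX.isSubmonotone_fin_one h.nonempty hbi hci
    (fun b => hproj (hL.definable_coord_lt (Sum.inr 0) b)) hmono,
    hX.isSubmonotone_fin_one h.nonempty ?_ hci.neg (fun b => ?_)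
      (hmono.symm.imp (fun h => h.neg) fun h => h.neg), fun j => ?_⟩
  · rw [← image_image (fun t : ℝ => -t) (fun x => f x i), image_neg_eq_neg]
    exact hbi.neg
  · convert hproj (hL.definable_lt_coord (Sum.inr 0) (-b)) using 1
    ext x
    simp [neg_lt]
  · obtain rfl := Fin.eq_zero j
    have hmem : ∀ x ∈ X, x 0 ∈ {t : ℝ | (fun _ => t) ∈ X} := fun x hx => by
      rwa [mem_ofPred_eq, hconst]
    rcases key with h | h | h
    · refine .inl fun x hx y hy _ hxy => ?_
      simpa only [hconst] using h (hmem x hx) (hmem y hy) hxy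
    · refine .inr (.inl fun x hx y hy _ hxy => ?_)
      simpa only [hconst] using h (hmem x hx) (hmem y hy) hxy
    · exact .inr (.inr h)

end OneVariable

/-! ### Level sets `y_i = b` as graphs over the coordinates other than `x_j` -/

section LevelSets

variable {L : FirstOrder.Language.{u, v}} [L.Structure ℝ] {n k : ℕ}

lemma IsMonotoneMap.isAdmissibleMap {X : Set (Fin n → ℝ)} {f : (Fin n → ℝ) → Fin k → ℝ}
    (h : IsMonotoneMap L n X f) : IsAdmissibleMap L X f := by
  rcases n with _ | _ | n
  · exact h
  · exact h.1
  · exact h.1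

/-- The relation, used in the definition of monotone maps, between the graph of `f` and the graph
of `g`, representing the level set `y_i = b` over the coordinates `x_l`, `l ≠ j`. -/
def IsLevelMap (X : Set (Fin (n + 1) → ℝ)) (f : (Fin (n + 1) → ℝ) → Fin k → ℝ) (i : Fin k)
    (j : Fin (n + 1)) (b : ℝ) (X' : Set (Fin n → ℝ)) (g : (Fin n → ℝ) → Fin k → ℝ) : Prop :=
  ∀ (x' : Fin n → ℝ) (y' : Fin k → ℝ), Sum.elim x' y' ∈ mapGraph X' g ↔
    Sum.elim (j.insertNth (y' i) x' : Fin (n + 1) → ℝ) (Function.update y' i b) ∈ mapGraph X f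

/-- The point of `X'` corresponding to a point of the level set `f_i = b`. -/
lemma IsLevelMap.mem_iff {X : Set (Fin (n + 1) → ℝ)} {f : (Fin (n + 1) → ℝ) → Fin k → ℝ}
    {i : Fin k} {j : Fin (n + 1)} {b : ℝ} {X' : Set (Fin n → ℝ)} {g : (Fin n → ℝ) → Fin k → ℝ}
    (h : IsLevelMap X f i j b X' g) {x : Fin (n + 1) → ℝ} (hx : x ∈ X) (hb : f x i = b) :
    j.removeNth x ∈ X' ∧ Function.update (f x) i (x j) = g (j.removeNth x) := by
  rw [← sumElim_mem_mapGraph, h, sumElim_mem_mapGraph, Function.update_self,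
    Fin.insertNth_self_removeNth, Function.update_idem, ← hb, Function.update_eq_self]
  exact ⟨hx, rfl⟩

/-- The `i`-th value slot of the level map carries `x_j`; the only ambient coordinate missed is
`y_i`, which is fixed on the level set. -/
def levelEmb (i : Fin k) (j : Fin (n + 1)) : Fin n ⊕ Fin k → Fin (n + 1) ⊕ Fin k :=
  Sum.elim (fun l => Sum.inl (j.succAbove l)) (fun i' => if i' = i then Sum.inl j else Sum.inr i')

lemma levelEmb_injective (i : Fin k) (j : Fin (n + 1)) : (levelEmb i j).Injective := by
  rintro (l | i') (l' | i'') h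
  · simpa [levelEmb] using h
  · by_cases hi : i'' = i <;> simp [levelEmb, hi] at h
  · by_cases hi : i' = i <;> simp [levelEmb, hi] at h
  · by_cases hi : i' = i <;> by_cases hi' : i'' = i <;> simp [levelEmb, hi, hi'] at h ⊢
    exact h

lemma range_levelEmb (i : Fin k) (j : Fin (n + 1)) : range (levelEmb i j) = {Sum.inr i}ᶜ := by
  ext (l | i')
  · simp only [mem_compl_iff, mem_singleton_iff, reduceCtorEq, not_false_eq_true, iff_true]
    rcases Fin.eq_self_or_eq_succAbove j l with rfl | ⟨l, rfl⟩
    · exact ⟨Sum.inr i, by simp [levelEmb]⟩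
    · exact ⟨Sum.inl l, rfl⟩
  · simp only [mem_compl_iff, mem_singleton_iff, Sum.inr.injEq]
    constructor
    · rintro ⟨l | i'', h⟩ rfl
      · simp [levelEmb] at h
      · by_cases hi : i'' = i' <;> simp [levelEmb, hi] at h
    · intro hi
      exact ⟨Sum.inr i', by simp [levelEmb, hi]⟩

lemma IsLevelMap.coordFiber_eq {X : Set (Fin (n + 1) → ℝ)} {f : (Fin (n + 1) → ℝ) → Fin k → ℝ}
    {i : Fin k} {j : Fin (n + 1)} {b : ℝ} {X' : Set (Fin n → ℝ)} {g : (Fin n → ℝ) → Fin k → ℝ}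
    (h : IsLevelMap X f i j b X' g) : coordFiber (mapGraph X f) (Sum.inr i) b =
      extendCoords (levelEmb i j) (fun _ => b) (mapGraph X' g) := by
  ext p
  have hr : (∀ v ∉ range (levelEmb i j), p v = b) ↔ p (Sum.inr i) = b := by
    simp [range_levelEmb]
  rw [extendCoords, mem_ofPred_eq, hr, coordFiber, mem_ofPred_eq, and_comm]
  refine and_congr_right fun hp => ?_
  have := h (fun l => p (Sum.inl (j.succAbove l)))
    (fun i' => if i' = i then p (Sum.inl j) else p (Sum.inr i'))
  convert this.symm using 1
  · congr! 1
    ext (l | i')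
    · simp only [Sum.elim_inl, if_pos]
      exact (congrFun (Fin.insertNth_self_removeNth j fun l => p (Sum.inl l)) l).symm
    · by_cases hi : i' = i
      · subst hi; simp [hp]
      · simp [hi]
  · congr! 1
    ext (l | i')
    · rfl
    · by_cases hi : i' = i <;> simp [levelEmb, hi]

/-- For `n ≥ 2`, on a level set of `f_i` the coordinate `x_j` is a function of the other `x_l`,
namely the `i`-th component of the level map. For `n = 1` this is strict monotonicity. -/
lemma IsMonotoneMap.eq_of_not_indepOfCoord {X : Set (Fin n → ℝ)} {f : (Fin n → ℝ) → Fin k → ℝ}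
    (h : IsMonotoneMap L n X f) {i : Fin k} {j : Fin n}
    (hij : ¬ IndepOfCoord X (fun x => f x i) j) {x y : Fin n → ℝ} (hx : x ∈ X) (hy : y ∈ X)
    (hxy : ∀ l, l ≠ j → x l = y l) (hf : f x i = f y i) : x = y := by
  suffices hj : x j = y j by
    ext l
    by_cases hl : l = j
    · rw [hl, hj]
    · exact hxy l hl
  rcases n with _ | _ | n
  · exact j.elim0
  · have hyx : ∀ l, l ≠ j → y l = x l := fun l hl => (hxy l hl).symm
    by_contra hne
    rcases (h.2 i).coord j with hc | hc | hc
    · rcases lt_or_gt_of_ne hne with hlt | hlt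
      · exact (hc x hx y hy hxy hlt).ne hf
      · exact (hc y hy x hx hyx hlt).ne' hf
    · rcases lt_or_gt_of_ne hne with hlt | hlt
      · exact (hc x hx y hy hxy hlt).ne' hf
      · exact (hc y hy x hx hyx hlt).ne hf
    · exact hij hc
  · obtain ⟨B, hB⟩ := h.2 i j hij
    obtain ⟨X', g, hg, -, -⟩ := hB (f x i) ⟨x, hx, rfl⟩
    have h1 := (IsLevelMap.mem_iff hg hx rfl).2
    have h2 := (IsLevelMap.mem_iff hg hy hf.symm).2
    have h3 : j.removeNth x = j.removeNth y := funext fun l => hxy _ (Fin.succAbove_ne _ _)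
    rw [h3, ← h2] at h1
    simpa using congrFun h1 i

lemma isAdmissibleMap_fin_zero (X : Set (Fin 0 → ℝ)) (hX : X.Nonempty)
    (f : (Fin 0 → ℝ) → Fin k → ℝ) : IsAdmissibleMap L X f := by
  have hX' : X = univ := by
    obtain ⟨x, hx⟩ := hX
    exact eq_univ_of_forall fun y => by rwa [Subsingleton.elim y x]
  subst hX'
  refine ⟨hX, ⟨isOpen_univ, (toFinite _).isBounded, Set.definable_univ,
    fun C _ => Set.subsingleton_of_subsingleton.isPreconnected⟩, ?_,
    continuous_of_discreteTopology.continuousOn, (toFinite _).isBounded⟩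
  have : mapGraph univ f = ⋂ i : Fin k, {p | p (Sum.inr i) = f 0 i} := by
    ext p
    simp only [mapGraph, mem_ofPred_eq, mem_univ, true_and, mem_iInter]
    rw [Subsingleton.elim (fun j => p (Sum.inl j)) 0]
  rw [IsDefinableMapOn, this]
  exact Set.definable_iInter_of_finite fun i =>
    (Set.Definable.singleton_of_mem L (mem_univ (f 0 i)) :
      (univ : Set ℝ).Definable₁ L {f 0 i}).preimage_comp (fun _ : Fin 1 => Sum.inr i)

/-- Extends the defining property to one variable: there a non-constant `f_i` is injective, its
levels are single points, and the only basis set of a map on `ℝ⁰` is empty. -/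
lemma IsMonotoneMap.exists_isLevelMap {X : Set (Fin (n + 1) → ℝ)}
    {f : (Fin (n + 1) → ℝ) → Fin k → ℝ} (h : IsMonotoneMap L (n + 1) X f) {i : Fin k}
    {j : Fin (n + 1)} (hij : ¬ IndepOfCoord X (fun x => f x i) j) :
    ∃ B : Set (Set (Fin n ⊕ Fin k)), ∀ b : ℝ, (∃ x ∈ X, f x i = b) →
      ∃ (X' : Set (Fin n → ℝ)) (g : (Fin n → ℝ) → Fin k → ℝ),
        IsLevelMap X f i j b X' g ∧ IsMonotoneMap L n X' g ∧ basisSystem X' g = B := by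
  rcases n with _ | n
  swap
  · exact h.2 i j hij
  · have : Subsingleton (Fin (0 + 1)) := inferInstanceAs (Subsingleton (Fin 1))
    refine ⟨{H | H.ncard = 0}, ?_⟩
    rintro _ ⟨x, hx, rfl⟩
    refine ⟨univ, fun _ => Function.update (f x) i (x j), fun x' y' => ?_,
      isAdmissibleMap_fin_zero _ univ_nonempty _, ?_⟩
    · rw [sumElim_mem_mapGraph, sumElim_mem_mapGraph]
      have hins : ∀ t : ℝ, ∀ l, (j.insertNth t x' : Fin 1 → ℝ) l = t := fun t l => by
        rw [Subsingleton.elim l j]; simp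
      have hxj : ∀ l, x l = x j := fun l => by rw [Subsingleton.elim l j]
      constructor
      · rintro ⟨-, rfl⟩
        have : (j.insertNth (Function.update (f x) i (x j) i) x' : Fin 1 → ℝ) = x := by
          ext l; rw [hins, hxj l]; simp
        rw [this]
        exact ⟨hx, by simp⟩
      · rintro ⟨h1, h2⟩
        have := h.eq_of_not_indepOfCoord hij h1 hx
          (fun l hl => absurd (Subsingleton.elim l j) hl) (by rw [← h2]; simp)
        rw [this] at h2
        have hy : y' i = x j := by rw [← this]; simp
        refine ⟨trivial, ?_⟩
        rw [← hy, ← h2]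
        simp
    · ext H
      rw [mem_basisSystem_iff]
      refine and_iff_left_iff_imp.2 fun _ p hp q hq _ => ?_
      obtain ⟨x, -, rfl⟩ := mem_mapGraph_iff.1 hp
      obtain ⟨y, -, rfl⟩ := mem_mapGraph_iff.1 hq
      rw [Subsingleton.elim x y]

end LevelSets

/-! ### Monotonicity of sections and matroidality of graphs -/

section Sections

variable {L : FirstOrder.Language.{u, v}} [L.Structure ℝ] {n k : ℕ}

/-- Non-empty sections by hyperplanes `x_j = c` of the monotone maps in `n + 1` variables are
monotone, and the spanning sets of all sections are the same. -/
def HasMonotoneSections (L : FirstOrder.Language.{u, v}) [L.Structure ℝ] (n k : ℕ) : Prop :=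
  ∀ (X : Set (Fin (n + 1) → ℝ)) (f : (Fin (n + 1) → ℝ) → Fin k → ℝ), IsMonotoneMap L (n + 1) X f →
    ∀ (j : Fin (n + 1)) (c : ℝ), (sectionSet j c X).Nonempty →
      IsMonotoneMap L n (sectionSet j c X) (sectionMap j c f) ∧
      ∀ K, Spans K (coordFiber (mapGraph X f) (Sum.inl j) c) →
        Spans (insert (Sum.inl j) K) (mapGraph X f)

lemma IndepOfCoord.section {X : Set (Fin (n + 1) → ℝ)} {f : (Fin (n + 1) → ℝ) → Fin k → ℝ}
    {i : Fin k} {j : Fin (n + 1)} {l : Fin n}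
    (h : IndepOfCoord X (fun x => f x i) (j.succAbove l)) (c : ℝ) :
    IndepOfCoord (sectionSet j c X) (fun x => sectionMap j c f x i) l := by
  intro x hx y hy hxy
  refine h _ hx _ hy fun l' hl' => ?_
  rcases Fin.eq_self_or_eq_succAbove j l' with rfl | ⟨l', rfl⟩
  · simp
  · simpa using hxy l' fun h => hl' (by rw [h])

lemma coordFiber_comm {V : Type*} (F : Set (V → ℝ)) (v w : V) (c d : ℝ) :
    coordFiber (coordFiber F v c) w d = coordFiber (coordFiber F w d) v c := by
  ext p
  simp only [coordFiber, mem_ofPred_eq, and_assoc, and_comm (a := p v = c)]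

lemma sectionSet_nonempty_of_mem {X : Set (Fin (n + 1) → ℝ)} {x : Fin (n + 1) → ℝ} (hx : x ∈ X)
    {j : Fin (n + 1)} {c : ℝ} (hc : x j = c) : (sectionSet j c X).Nonempty :=
  ⟨fun l => x (j.succAbove l), by
    rwa [sectionSet, mem_ofPred_eq, insertNth_removeNth_of_eq hc]⟩

/-- The point `x` of the section `x_j = c`, considered as a point of a level set of the `i`-th
component, viewed over the coordinates other than `x_l`. -/
lemma IsLevelMap.section_mem {X : Set (Fin (n + 2) → ℝ)} {f : (Fin (n + 2) → ℝ) → Fin k → ℝ}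
    {i : Fin k} {j : Fin (n + 2)} {l : Fin (n + 1)} {b c : ℝ} {X' : Set (Fin (n + 1) → ℝ)}
    {g : (Fin (n + 1) → ℝ) → Fin k → ℝ} (h : IsLevelMap X f i (j.succAbove l) b X' g)
    {x : Fin (n + 1) → ℝ} (hx : x ∈ sectionSet j c X) (hb : sectionMap j c f x i = b) :
    (sectionSet (l.predAbove j) c X').Nonempty := by
  refine sectionSet_nonempty_of_mem (h.mem_iff hx hb).1 ?_
  rw [Fin.removeNth, Fin.succAbove_succAbove_predAbove]
  simp

lemma IsLevelMap.section {X : Set (Fin (n + 2) → ℝ)} {f : (Fin (n + 2) → ℝ) → Fin k → ℝ}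
    {i : Fin k} {j : Fin (n + 2)} {l : Fin (n + 1)} {b : ℝ} {X' : Set (Fin (n + 1) → ℝ)}
    {g : (Fin (n + 1) → ℝ) → Fin k → ℝ} (h : IsLevelMap X f i (j.succAbove l) b X' g) (c : ℝ) :
    IsLevelMap (sectionSet j c X) (sectionMap j c f) i l b
      (sectionSet (l.predAbove j) c X') (sectionMap (l.predAbove j) c g) := by
  intro x' y'
  have := h ((l.predAbove j).insertNth c x') y'
  rw [sumElim_mem_mapGraph, sumElim_mem_mapGraph, ← insertNth_insertNth_swap] at this
  rw [sumElim_mem_mapGraph, sumElim_mem_mapGraph]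
  exact this

/-- A level set of the section is the section of a level map `g` of `f`, which has one variable
fewer than `f`, so the sections of `g` are monotone by `hR`. -/
lemma isMonotoneMap_section (hL : IsOMinimal L) (hR : ∀ m, n = m + 1 → HasMonotoneSections L m k)
    {X : Set (Fin (n + 1) → ℝ)} {f : (Fin (n + 1) → ℝ) → Fin k → ℝ}
    (h : IsMonotoneMap L (n + 1) X f) (j : Fin (n + 1)) (c : ℝ)
    (hne : (sectionSet j c X).Nonempty) :
    IsMonotoneMap L n (sectionSet j c X) (sectionMap j c f) := by
  have hadm := h.isAdmissibleMap.section hne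
  rcases n with _ | _ | n
  · exact hadm
  · refine ⟨hadm, fun i => hadm.isMonotoneFunction_fin_one hL i ?_⟩
    by_cases hij : IndepOfCoord X (fun x => f x i) (j.succAbove 0)
    · exact .inr (hij.section c)
    · left
      intro x hx y hy hxy
      refine Fin.insertNth_right_injective (α := fun _ => ℝ) (p := j) c
        (h.eq_of_not_indepOfCoord hij hx hy (fun l hl => ?_) hxy)
      rcases Fin.eq_self_or_eq_succAbove j l with rfl | ⟨l, rfl⟩
      · simp
      · exact absurd (by rw [Fin.eq_zero l]) hl
  · refine ⟨hadm, fun i l hil => ?_⟩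
    obtain ⟨B, hB⟩ := h.2 i (j.succAbove l) fun hind => hil (hind.section c)
    have hinj := sectionEmb_injective (k := k) (l.predAbove j)
    -- By `hR`, `H` is a basis set of the section of `g` iff adding `x_j` gives a basis set of `g`;
    -- the latter form a system `B` independent of `b`.
    refine ⟨{H | insert (Sum.inl (l.predAbove j)) (sectionEmb k (l.predAbove j) '' H) ∈ B}, ?_⟩
    rintro b ⟨x, hx, hxb⟩
    obtain ⟨X', g, hg, hmono, rfl⟩ := hB b ⟨_, hx, hxb⟩
    change IsLevelMap X f i (j.succAbove l) b X' g at hg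
    obtain ⟨hsec, hspan⟩ := hR (n + 1) rfl X' g hmono (l.predAbove j) c (hg.section_mem hx hxb)
    refine ⟨_, _, hg.section c, hsec, ?_⟩
    ext H
    have hnot : Sum.inl (l.predAbove j) ∉ sectionEmb k (l.predAbove j) '' H := by
      intro hmem
      have := range_sectionEmb (k := k) (l.predAbove j) ▸ image_subset_range _ _ hmem
      exact this rfl
    rw [mem_ofPred_eq, mem_basisSystem_iff, mem_basisSystem_iff, ncard_insert_of_notMem hnot,
      ncard_image_of_injective _ hinj, add_left_inj]
    refine and_congr_right fun _ => ?_
    have hiff := spans_extendCoords_iff hinj (fun _ => c)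
      (G := mapGraph (sectionSet (l.predAbove j) c X') (sectionMap (l.predAbove j) c g))
      (H := sectionEmb k (l.predAbove j) '' H)
    rw [preimage_image_eq _ hinj, ← coordFiber_mapGraph_inl] at hiff
    rw [← hiff]
    exact ⟨hspan _, fun h => h.coordFiber_of_insert c⟩

/-- If some `y_i ∈ K` varies on the section, the claim passes to a level set of `y_i` meeting the
section, then to all its level sets, and `y_i ∈ K` puts them together. Otherwise only the `x_l` in
`K` can separate points of the section, which forces every `x_l`, `l ≠ j`, into `K`. -/
lemma spans_insert_of_spans_section
    (hT : ∀ (X : Set (Fin n → ℝ)) (f : (Fin n → ℝ) → Fin k → ℝ), IsMonotoneMap L n X f →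
      IsMatroidal n (mapGraph X f))
    (hR : ∀ m, n = m + 1 → HasMonotoneSections L m k)
    {X : Set (Fin (n + 1) → ℝ)} {f : (Fin (n + 1) → ℝ) → Fin k → ℝ}
    (h : IsMonotoneMap L (n + 1) X f) (j : Fin (n + 1)) (c : ℝ)
    (hne : (sectionSet j c X).Nonempty) {K : Set (Fin (n + 1) ⊕ Fin k)}
    (hK : Spans K (coordFiber (mapGraph X f) (Sum.inl j) c)) :
    Spans (insert (Sum.inl j) K) (mapGraph X f) := by
  by_cases hcase : ∃ i, Sum.inr i ∈ K ∧
      ¬ CoordConst (mapGraph (sectionSet j c X) (sectionMap j c f)) (Sum.inr i)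
  · obtain ⟨i, hiK, hi⟩ := hcase
    obtain ⟨l, hl⟩ := (h.isAdmissibleMap.section hne).exists_not_indepOfCoord hi
    rcases n with _ | n
    · exact l.elim0
    obtain ⟨B, hB⟩ := h.exists_isLevelMap fun hind => hl (hind.section c)
    have hinj := levelEmb_injective i (j.succAbove l)
    have hemb : levelEmb i (j.succAbove l) (Sum.inl (l.predAbove j)) = Sum.inl j := by
      simp [levelEmb, Fin.succAbove_succAbove_predAbove]
    obtain ⟨x, hx⟩ := hne
    obtain ⟨X₀, g₀, hg₀, hmono₀, hB₀⟩ := hB _ ⟨_, hx, rfl⟩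
    have hspan₀ : Spans (levelEmb i (j.succAbove l) ⁻¹' insert (Sum.inl j) K) (mapGraph X₀ g₀) := by
      have := (hR n rfl X₀ g₀ hmono₀ (l.predAbove j) c (hg₀.section_mem hx rfl)).2
        (levelEmb i (j.succAbove l) ⁻¹' K) (by
          rw [← spans_extendCoords_iff hinj, ← coordFiber_extendCoords, ← hg₀.coordFiber_eq, hemb,
            coordFiber_comm]
          exact hK.mono le_rfl (coordFiber_subset _ _ _))
      refine this.mono ?_ le_rfl
      rintro w (rfl | hw)
      · exact .inl hemb
      · exact .inr hw
    rw [← insert_eq_of_mem (mem_insert_of_mem (Sum.inl j) hiK)]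
    refine spans_of_forall_insert fun b hb => ?_
    obtain ⟨p, hp, hpb⟩ := hb
    obtain ⟨y, hy, rfl⟩ := mem_mapGraph_iff.1 hp
    obtain ⟨X', g, hg, hmono, hB'⟩ := hB b ⟨y, hy, hpb⟩
    rw [hg.coordFiber_eq, spans_extendCoords_iff hinj]
    refine (hT X₀ g₀ hmono₀).spans_iff_of_bases (fun H hH hHs => ?_) hspan₀
    have : H ∈ basisSystem X' g := by
      rw [hB', ← hB₀]
      exact mem_basisSystem_iff.2 ⟨hH, hHs⟩
    exact (mem_basisSystem_iff.1 this).2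
  · push Not at hcase
    have hall : ∀ l, Sum.inl (j.succAbove l) ∈ K := by
      intro l
      by_contra hlK
      obtain ⟨x, hx⟩ := hne
      -- If `x_l ∉ K`, moving `x_l` inside the open section changes no coordinate in `K`, the `y_i ∈
      -- K` being constant there.
      obtain ⟨t, ht, hxt⟩ := exists_update_mem
        (h.isAdmissibleMap.semiMonotone.section j c).isOpen hx l
      rw [coordFiber_mapGraph_inl, spans_extendCoords_iff (sectionEmb_injective j)] at hK
      have hp := mem_mapGraph_iff (f := sectionMap j c f).2 ⟨_, hx, rfl⟩
      have hq := mem_mapGraph_iff (f := sectionMap j c f).2 ⟨_, hxt, rfl⟩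
      have := congrFun (hK _ hp _ hq ?_) (Sum.inl l)
      · simp only [Sum.elim_inl, Function.update_self] at this
        exact ht this.symm
      · rintro (l' | i) hv
        · have : l' ≠ l := by rintro rfl; exact hlK hv
          simp [this]
        · exact hcase i hv _ hp _ hq
    intro p hp q hq hpq
    obtain ⟨x, hx, rfl⟩ := mem_mapGraph_iff.1 hp
    obtain ⟨y, hy, rfl⟩ := mem_mapGraph_iff.1 hq
    suffices hxy : x = y by rw [hxy]
    ext l
    refine hpq (Sum.inl l) ?_
    rcases Fin.eq_self_or_eq_succAbove j l with rfl | ⟨l, rfl⟩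
    · exact mem_insert _ _
    · exact mem_insert_of_mem _ (hall l)

/-- A non-empty level set of a non-constant coordinate on the graph of a monotone map is the graph
of a monotone map. -/
lemma IsMonotoneMap.exists_coordFiber_eq (hR : HasMonotoneSections L n k)
    {X : Set (Fin (n + 1) → ℝ)} {f : (Fin (n + 1) → ℝ) → Fin k → ℝ}
    (h : IsMonotoneMap L (n + 1) X f) {v : Fin (n + 1) ⊕ Fin k}
    (hv : ¬ CoordConst (mapGraph X f) v) {c : ℝ} (hc : (coordFiber (mapGraph X f) v c).Nonempty) :
    ∃ (e : Fin n ⊕ Fin k → Fin (n + 1) ⊕ Fin k) (X' : Set (Fin n → ℝ))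
      (g : (Fin n → ℝ) → Fin k → ℝ), e.Injective ∧ range e = {v}ᶜ ∧ IsMonotoneMap L n X' g ∧
      coordFiber (mapGraph X f) v c = extendCoords e (fun _ => c) (mapGraph X' g) := by
  obtain ⟨p, hp, hpc⟩ := hc
  obtain ⟨x, hx, rfl⟩ := mem_mapGraph_iff.1 hp
  rcases v with j | i
  · exact ⟨sectionEmb k j, _, _, sectionEmb_injective j, range_sectionEmb j,
      (hR X f h j c (sectionSet_nonempty_of_mem hx hpc)).1, coordFiber_mapGraph_inl j c X f⟩
  · obtain ⟨j, hj⟩ := h.isAdmissibleMap.exists_not_indepOfCoord hv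
    obtain ⟨B, hB⟩ := h.exists_isLevelMap hj
    obtain ⟨X', g, hg, hmono, -⟩ := hB c ⟨x, hx, hpc⟩
    exact ⟨levelEmb i j, X', g, levelEmb_injective i j, range_levelEmb i j, hmono,
      hg.coordFiber_eq⟩

lemma isMatroidal_mapGraph_succ
    (hT : ∀ (X : Set (Fin n → ℝ)) (f : (Fin n → ℝ) → Fin k → ℝ), IsMonotoneMap L n X f →
      IsMatroidal n (mapGraph X f))
    (hR : HasMonotoneSections L n k)
    {X : Set (Fin (n + 1) → ℝ)} {f : (Fin (n + 1) → ℝ) → Fin k → ℝ}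
    (h : IsMonotoneMap L (n + 1) X f) : IsMatroidal (n + 1) (mapGraph X f) := by
  obtain ⟨x, hx⟩ := h.isAdmissibleMap.nonempty
  have hp := mem_mapGraph_iff (f := f).2 ⟨_, hx, rfl⟩
  refine ⟨⟨_, hp⟩, fun hsub => ?_, fun v hv => ⟨fun c hc => ?_, fun c c' hc hc' H hH => ?_⟩⟩
  · obtain ⟨t, ht, hxt⟩ := exists_update_mem h.isAdmissibleMap.semiMonotone.isOpen hx 0
    have := congrFun (hsub hp (mem_mapGraph_iff.2 ⟨_, hxt, rfl⟩)) (Sum.inl 0)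
    simp only [Sum.elim_inl, Function.update_self] at this
    exact ht this.symm
  · obtain ⟨e, X', g, he, -, hmono, heq⟩ := h.exists_coordFiber_eq hR hv hc
    rw [heq]
    exact (hT X' g hmono).extendCoords he _
  · obtain ⟨p, hp, hpc⟩ := hc
    obtain ⟨x, hx, rfl⟩ := mem_mapGraph_iff.1 hp
    obtain ⟨q, hq, hqc⟩ := hc'
    obtain ⟨y, hy, rfl⟩ := mem_mapGraph_iff.1 hq
    rcases v with j | i
    · exact ((hR X f h j c (sectionSet_nonempty_of_mem hx hpc)).2 H hH).coordFiber_of_insert c'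
    · obtain ⟨j, hj⟩ := h.isAdmissibleMap.exists_not_indepOfCoord hv
      obtain ⟨B, hB⟩ := h.exists_isLevelMap hj
      obtain ⟨X₁, g₁, hg₁, hmono₁, hB₁⟩ := hB c ⟨x, hx, hpc⟩
      obtain ⟨X₂, g₂, hg₂, hmono₂, hB₂⟩ := hB c' ⟨y, hy, hqc⟩
      rw [hg₁.coordFiber_eq, spans_extendCoords_iff (levelEmb_injective i j)] at hH
      rw [hg₂.coordFiber_eq, spans_extendCoords_iff (levelEmb_injective i j)]
      refine (hT X₁ g₁ hmono₁).spans_iff_of_bases (fun H hH hHs => ?_) hH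
      have : H ∈ basisSystem X₂ g₂ := by
        rw [hB₂, ← hB₁]
        exact mem_basisSystem_iff.2 ⟨hH, hHs⟩
      exact (mem_basisSystem_iff.1 this).2

theorem isMatroidal_mapGraph_and_hasMonotoneSections (hL : IsOMinimal L) (n k : ℕ) :
    (∀ (X : Set (Fin n → ℝ)) (f : (Fin n → ℝ) → Fin k → ℝ), IsMonotoneMap L n X f →
      IsMatroidal n (mapGraph X f)) ∧ HasMonotoneSections L n k := by
  induction n with
  | zero =>
    have hT : ∀ (X : Set (Fin 0 → ℝ)) (f : (Fin 0 → ℝ) → Fin k → ℝ), IsMonotoneMap L 0 X f →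
        IsMatroidal 0 (mapGraph X f) := by
      intro X f h
      obtain ⟨x, hx⟩ := h.isAdmissibleMap.nonempty
      refine ⟨⟨_, mem_mapGraph_iff.2 ⟨x, hx, rfl⟩⟩, fun p hp q hq => ?_⟩
      obtain ⟨x, -, rfl⟩ := mem_mapGraph_iff.1 hp
      obtain ⟨y, -, rfl⟩ := mem_mapGraph_iff.1 hq
      rw [Subsingleton.elim x y]
    have hR : ∀ m, 0 = m + 1 → HasMonotoneSections L m k := fun m hm => by omega
    exact ⟨hT, fun X f h j c hne => ⟨isMonotoneMap_section hL hR h j c hne,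
      fun K => spans_insert_of_spans_section hT hR h j c hne⟩⟩
  | succ n ih =>
    have hT : ∀ (X : Set (Fin (n + 1) → ℝ)) (f : (Fin (n + 1) → ℝ) → Fin k → ℝ),
        IsMonotoneMap L (n + 1) X f → IsMatroidal (n + 1) (mapGraph X f) :=
      fun X f => isMatroidal_mapGraph_succ ih.1 ih.2
    have hR : ∀ m, n + 1 = m + 1 → HasMonotoneSections L m k := by
      rintro m hm
      obtain rfl := Nat.succ.inj hm
      exact ih.2
    exact ⟨hT, fun X f h j c hne => ⟨isMonotoneMap_section hL hR h j c hne,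
      fun K => spans_insert_of_spans_section hT hR h j c hne⟩⟩

lemma IsMonotoneMap.isMatroidal (hL : IsOMinimal L) {X : Set (Fin n → ℝ)}
    {f : (Fin n → ℝ) → Fin k → ℝ} (h : IsMonotoneMap L n X f) : IsMatroidal n (mapGraph X f) :=
  (isMatroidal_mapGraph_and_hasMonotoneSections hL n k).1 X f h

end Sections

/-! ### Fixing several coordinates; dimension -/

section Slices

variable {L : FirstOrder.Language.{u, v}} [L.Structure ℝ] {k : ℕ} {V W : Type*}

/-- `F` is the graph of a monotone map in `m` variables, in the space of the coordinates not
in `I`, while the coordinates in `I` are fixed. -/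
def IsMonotoneGraph (L : FirstOrder.Language.{u, v}) [L.Structure ℝ] (k m : ℕ) (I : Set V)
    (F : Set (V → ℝ)) : Prop :=
  ∃ (e : Fin m ⊕ Fin k → V) (c : V → ℝ) (X : Set (Fin m → ℝ)) (g : (Fin m → ℝ) → Fin k → ℝ),
    e.Injective ∧ range e = Iᶜ ∧ IsMonotoneMap L m X g ∧ F = extendCoords e c (mapGraph X g)

lemma IsMonotoneGraph.isMatroidal (hL : IsOMinimal L) {m : ℕ} {I : Set V} {F : Set (V → ℝ)}
    (h : IsMonotoneGraph L k m I F) : IsMatroidal m F := by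
  obtain ⟨e, c, X, g, he, -, hmono, rfl⟩ := h
  exact (hmono.isMatroidal hL).extendCoords he c

lemma extendCoords_extendCoords {U : Type*} {e : W → V} (he : e.Injective) {e' : U → W} {w : W}
    (he' : range e' = {w}ᶜ) (c : V → ℝ) (b : ℝ) (G : Set (U → ℝ)) [DecidableEq V] :
    extendCoords e c (extendCoords e' (fun _ => b) G) =
      extendCoords (e ∘ e') (Function.update c (e w) b) G := by
  ext p
  simp only [extendCoords, mem_ofPred_eq, he', mem_compl_iff, mem_singleton_iff, not_not,
    forall_eq, Function.comp_assoc, Function.comp_apply, ← and_assoc]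
  refine and_congr_left fun _ => ?_
  have hr : ∀ v, v ∉ range (e ∘ e') ↔ v ∉ range e ∨ v = e w := by
    intro v
    rw [range_comp, he']
    constructor
    · intro hv
      by_cases hve : v ∈ range e
      · obtain ⟨w', rfl⟩ := hve
        right
        by_contra hne
        exact hv ⟨w', fun h => hne (by rw [mem_singleton_iff.1 h]), rfl⟩
      · exact .inl hve
    · rintro (hv | rfl) ⟨w', hw', h⟩
      · exact hv ⟨w', h⟩
      · exact hw' (he h)
  constructor
  · rintro ⟨h1, h2⟩ v hv
    rcases (hr v).1 hv with hv | rfl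
    · rw [Function.update_of_ne, h1 v hv]
      rintro rfl
      exact hv ⟨w, rfl⟩
    · rw [Function.update_self, h2]
  · intro h
    refine ⟨fun v hv => ?_, ?_⟩
    · rw [h v ((hr v).2 (.inl hv)), Function.update_of_ne]
      rintro rfl
      exact hv ⟨w, rfl⟩
    · rw [h _ ((hr _).2 (.inr rfl)), Function.update_self]

/-- Coordinates already fixed are constant, so `v` comes from the inner graph and its fiber can be
taken there. -/
lemma IsMonotoneGraph.coordFiber (hL : IsOMinimal L) {m : ℕ} {I : Set V} {F : Set (V → ℝ)}
    (h : IsMonotoneGraph L k (m + 1) I F) {v : V} (hv : ¬ CoordConst F v) {b : ℝ}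
    (hb : (coordFiber F v b).Nonempty) :
    IsMonotoneGraph L k m (insert v I) (coordFiber F v b) := by
  classical
  obtain ⟨e, c, X, g, he, hr, hmono, rfl⟩ := h
  obtain ⟨w, rfl⟩ := mem_range_of_not_coordConst_extendCoords hv
  rw [coordConst_extendCoords_iff he] at hv
  rw [coordFiber_extendCoords, extendCoords_nonempty_iff he] at hb
  obtain ⟨e', X', g', he', hr', hmono', heq⟩ :=
    hmono.exists_coordFiber_eq (isMatroidal_mapGraph_and_hasMonotoneSections hL m k).2 hv hb
  refine ⟨e ∘ e', Function.update c (e w) b, X', g', he.comp he', ?_, hmono', ?_⟩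
  · rw [range_comp, hr', image_compl_eq_range_sdiff_image he, hr, image_singleton]
    ext x
    simp [not_or, and_comm]
  · rw [coordFiber_extendCoords, heq, extendCoords_extendCoords he hr']

def multiFiber (F : Set (V → ℝ)) (I : Set V) (c : V → ℝ) : Set (V → ℝ) :=
  {p | p ∈ F ∧ ∀ v ∈ I, p v = c v}

lemma multiFiber_eq_of_mem (F : Set (V → ℝ)) {I : Set V} {v : V} (hv : v ∈ I) (c : V → ℝ) :
    multiFiber F I c = multiFiber (coordFiber F v (c v)) (I \ {v}) c := by
  ext p
  simp only [multiFiber, coordFiber, mem_ofPred_eq, and_assoc]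
  refine and_congr_right fun _ => ⟨fun h => ⟨h v hv, fun w hw => h w hw.1⟩, fun h w hw => ?_⟩
  by_cases hwv : w = v
  · rw [hwv, h.1]
  · exact h.2 w ⟨hw, hwv⟩

/-- Elements of `I` are fixed one by one: each lies in a basis, hence is non-constant, and the rest
of that basis is a basis of the fiber. The equivalence of spanning sets is what identifies the bases
with those of the contraction. -/
lemma IsMonotoneGraph.multiFiber [Finite V] (hL : IsOMinimal L) {m : ℕ} {J : Set V}
    {F : Set (V → ℝ)} (h : IsMonotoneGraph L k m J F) {B I : Set V} (hB : B.ncard = m)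
    (hBs : Spans B F) (hIB : I ⊆ B) {c : V → ℝ} (hne : (multiFiber F I c).Nonempty) :
    IsMonotoneGraph L k (m - I.ncard) (J ∪ I) (multiFiber F I c) ∧
      ∀ H, Spans (H ∪ I) F ↔ Spans H (multiFiber F I c) := by
  induction m generalizing J F B I with
  | zero =>
    obtain rfl : I = ∅ := by rw [(ncard_eq_zero).1 hB] at hIB; exact subset_empty_iff.1 hIB
    simpa [_root_.multiFiber] using h
  | succ m ih =>
    rcases I.eq_empty_or_nonempty with rfl | ⟨v, hv⟩
    · simpa [_root_.multiFiber] using h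
    have hvF := (h.isMatroidal hL).not_coordConst hB hBs (hIB hv)
    have hcard := ncard_sdiff_singleton_add_one hv
    rw [multiFiber_eq_of_mem F hv] at hne ⊢
    have hne' : (_root_.coordFiber F v (c v)).Nonempty := hne.mono fun _ h => h.1
    obtain ⟨h1, h2⟩ := ih (h.coordFiber hL hvF hne') (B := B \ {v}) (I := I \ {v})
      (by rw [ncard_sdiff_singleton_of_mem (hIB hv), hB]; rfl) (hBs.diff_coordFiber v _)
      (sdiff_subset_sdiff_left hIB) hne
    constructor
    · convert h1 using 1
      · omega
      · ext w
        by_cases hw : w = v <;> simp [hw, hv]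
    · intro H
      rw [← h2, ← (h.isMatroidal hL).spans_insert_iff hvF hne']
      congr! 1
      ext w
      by_cases hw : w = v <;> simp [hw, hv]

/-- The projection to the `x`-coordinates is the open set `X`, giving dimension at least `d`; an
open box in any projection uses at most `d` coordinates by `IsMatroidal.card_le_of_box`. -/
lemma IsMonotoneMap.hasDimension (hL : IsOMinimal L) {d : ℕ} {X : Set (Fin d → ℝ)}
    {g : (Fin d → ℝ) → Fin k → ℝ} (h : IsMonotoneMap L d X g) (e : Fin d ⊕ Fin k ≃ V) :
    HasDimension {q : V → ℝ | (fun a => q (e a)) ∈ mapGraph X g} d := by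
  classical
  constructor
  · let s : Finset V := Finset.univ.image fun l => e (Sum.inl l)
    refine ⟨s, (Finset.card_image_of_injective _ (e.injective.comp Sum.inl_injective)).trans
      (by simp), ?_⟩
    have hmem : ∀ l, e (Sum.inl l) ∈ s := fun l => by simp [s]
    have hopen : IsOpen {z : s → ℝ | (fun l => z ⟨e (Sum.inl l), hmem l⟩) ∈ X} :=
      h.isAdmissibleMap.semiMonotone.isOpen.preimage
        (f := fun (z : s → ℝ) l => z ⟨e (Sum.inl l), hmem l⟩) (by fun_prop)
    obtain ⟨x, hx⟩ := h.isAdmissibleMap.nonempty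
    refine ⟨fun w => Sum.elim x (g x) (e.symm w), interior_maximal ?_ hopen ?_⟩
    · intro z hz
      refine ⟨fun w => Sum.elim (fun l => z ⟨e (Sum.inl l), hmem l⟩)
        (g fun l => z ⟨e (Sum.inl l), hmem l⟩) (e.symm w), ?_, ?_⟩
      · simp only [mem_ofPred_eq, Equiv.symm_apply_apply]
        exact mem_mapGraph_iff.2 ⟨_, hz, rfl⟩
      · ext ⟨w, hw⟩
        obtain ⟨l, -, rfl⟩ := Finset.mem_image.1 hw
        simp
    · simpa using hx
  · rintro _ ⟨s, rfl, a, ha⟩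
    obtain ⟨ε, hε, hball⟩ := Metric.isOpen_iff.1 isOpen_interior a ha
    -- Since `e` is onto, no coordinate is fixed and the base point `0` plays no role.
    have hA : {q : V → ℝ | (fun a => q (e a)) ∈ mapGraph X g} =
        extendCoords e 0 (mapGraph X g) := by
      ext q
      simp [extendCoords, Function.comp_def]
    rw [hA] at hball
    refine ((h.isMatroidal hL).extendCoords e.injective 0).card_le_of_box s
      (fun w => if hw : w ∈ s then a ⟨w, hw⟩ else 0) hε fun y hy => ?_
    have hyb : (fun w : s => y w) ∈ Metric.ball a ε := by
      rw [Metric.mem_ball, dist_pi_lt_iff hε]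
      rintro ⟨w, hw⟩
      simpa [hw, Real.dist_eq] using hy w hw
    obtain ⟨p, hp, hpy⟩ := interior_subset (hball hyb)
    exact ⟨p, hp, fun w hw => congrFun hpy ⟨w, hw⟩⟩

end Slices

/-! ### The matroid of a monotone map and its contractions -/

theorem theorem3p9 (L : FirstOrder.Language.{u, v}) [L.Structure ℝ] (hL : IsOMinimal L)
    (n k : ℕ) (X : Set (Fin n → ℝ)) (f : (Fin n → ℝ) → Fin k → ℝ) (hf : IsMonotoneMap L n X f) :
    ∃ M : Matroid (Fin n ⊕ Fin k),
      M.E = univ ∧ (∀ H, M.IsBase H ↔ H ∈ basisSystem X f) ∧ M.eRank = n ∧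
      ∀ I : Set (Fin n ⊕ Fin k), M.Indep I →
        I.ncard ≤ n ∧ (M.contract I).eRank = (n - I.ncard : ℕ) ∧
        ∀ c : I → ℝ, (slice (mapGraph X f) I c).Nonempty →
          (∃ (e : Fin (n - I.ncard) ⊕ Fin k ≃ {w : Fin n ⊕ Fin k // w ∉ I})
              (X' : Set (Fin (n - I.ncard) → ℝ)) (g : (Fin (n - I.ncard) → ℝ) → Fin k → ℝ),
            IsMonotoneMap L (n - I.ncard) X' g ∧
            slice (mapGraph X f) I c = {q | (fun a => q (e a)) ∈ mapGraph X' g} ∧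
            ∀ H : Set (Fin (n - I.ncard) ⊕ Fin k),
              H ∈ basisSystem X' g ↔
                (M.contract I).IsBase ((fun a => (e a : Fin n ⊕ Fin k)) '' H)) ∧
          HasDimension (slice (mapGraph X f) I c) (n - I.ncard) := by
  classical
  have hF := hf.isMatroidal hL
  have hcardB : ∀ {B}, hF.matroid.IsBase B → B.encard = n := fun {B} hB => by
    rw [← (toFinite B).cast_ncard_eq, (hF.matroid_isBase.1 hB).1]
  refine ⟨hF.matroid, hF.matroid_E, fun H => hF.matroid_isBase.trans mem_basisSystem_iff.symm, ?_,
    fun I hI => ?_⟩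
  · obtain ⟨B, hB⟩ := hF.matroid.exists_isBase
    rw [← hB.encard_eq_eRank, hcardB hB]
  obtain ⟨B, hB, hIB⟩ := hI.exists_isBase_superset
  obtain ⟨hBn, hBs⟩ := hF.matroid_isBase.1 hB
  have hIn : I.ncard ≤ n := (ncard_le_ncard hIB).trans hBn.le
  refine ⟨hIn, ?_, fun c hc => ?_⟩
  · have hBI : (hF.matroid.contract I).IsBase (B \ I) := by
      rw [hI.contract_isBase_iff, sdiff_union_of_subset hIB]
      exact ⟨hB, disjoint_sdiff_left⟩
    rw [← hBI.encard_eq_eRank, ← (toFinite _).cast_ncard_eq, ncard_sdiff hIB, hBn]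
  -- Only the values of `C` on `I` matter; `0` is a filler elsewhere.
  let C : Fin n ⊕ Fin k → ℝ := fun v => if hv : v ∈ I then c ⟨v, hv⟩ else 0
  have hC : ∀ v : I, C v = c v := fun v => dif_pos v.2
  have hslice : ∀ q, q ∈ slice (mapGraph X f) I c ↔
      ∃ p ∈ multiFiber (mapGraph X f) I C, ∀ w : {v // v ∉ I}, p w = q w := by
    intro q
    constructor
    · rintro ⟨p, hp, hpc, hpq⟩
      exact ⟨p, ⟨hp, fun v hv => (hpc ⟨v, hv⟩).trans (hC ⟨v, hv⟩).symm⟩, hpq⟩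
    · rintro ⟨p, ⟨hp, hpc⟩, hpq⟩
      exact ⟨p, hp, fun v => (hpc v v.2).trans (hC v), hpq⟩
  have hne : (multiFiber (mapGraph X f) I C).Nonempty := by
    obtain ⟨q, hq⟩ := hc
    obtain ⟨p, hp, -⟩ := (hslice q).1 hq
    exact ⟨p, hp⟩
  have hgraph : IsMonotoneGraph L k n ∅ (mapGraph X f) :=
    ⟨id, 0, X, f, Function.injective_id, by simp, hf, by ext; simp [extendCoords]⟩
  obtain ⟨⟨e, d, X', g, he, hr, hmono, heq⟩, hspan⟩ := hgraph.multiFiber hL hBn hBs hIB hne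
  rw [empty_union] at hr
  have hmem : ∀ a, e a ∉ I := fun a => by
    have : e a ∈ Iᶜ := hr ▸ mem_range_self a
    exact this
  have hbij : Function.Bijective fun a => (⟨e a, hmem a⟩ : {w // w ∉ I}) := by
    refine ⟨fun a b hab => he (congrArg Subtype.val hab), fun ⟨w, hw⟩ => ?_⟩
    obtain ⟨a, rfl⟩ : w ∈ range e := hr ▸ hw
    exact ⟨a, rfl⟩
  have hset : slice (mapGraph X f) I c =
      {q | (fun a => q (Equiv.ofBijective _ hbij a)) ∈ mapGraph X' g} := by
    ext q
    rw [hslice, heq]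
    constructor
    · rintro ⟨p, hp, hpq⟩
      have : (fun a => q (Equiv.ofBijective _ hbij a)) = p ∘ e :=
        funext fun a => (hpq ⟨e a, hmem a⟩).symm
      rw [mem_ofPred_eq, this]
      exact hp.2
    · intro hq
      obtain ⟨p, hp, hpq⟩ := exists_mem_extendCoords he d hq
      refine ⟨p, hp, fun w => ?_⟩
      obtain ⟨a, rfl⟩ := hbij.2 w
      exact congrFun hpq a
  refine ⟨⟨Equiv.ofBijective _ hbij, X', g, hmono, hset, fun H => ?_⟩, ?_⟩
  · have himg : (fun a => ((Equiv.ofBijective _ hbij a : {w // w ∉ I}) : Fin n ⊕ Fin k)) '' H =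
        e '' H := rfl
    have hdisj : Disjoint (e '' H) I := by
      rw [disjoint_left]
      rintro _ ⟨a, -, rfl⟩
      exact hmem a
    rw [himg, hI.contract_isBase_iff, and_iff_left hdisj, hF.matroid_isBase, mem_basisSystem_iff,
      hspan, heq, spans_extendCoords_iff he, preimage_image_eq _ he, ncard_union_eq hdisj,
      ncard_image_of_injective _ he]
    -- As `I.ncard ≤ n`, the sizes `n - I.ncard` of `H` and `n` of its union with `I` correspond.
    exact and_congr_left fun _ => by omega
  · rw [hset]
    exact hmono.hasDimension hL _
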